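/- Let $K$ be a number field of degree $d>1$ with a real place $\sigma$, regarded as an embedding $\sigma:K\to\mathbb R$. Let $K_{\sigma'}=\prod_{w\neq\sigma}K_w$ be the product of the archimedean completions ($K_w=\mathbb R$ or $\mathbb C$) at the other places, and let $\alpha\mapsto\alpha'$ be the natural map $K\to K_{\sigma'}$. On $K_{\sigma'}$ put $$\langle y,z\rangle=\sum_{w\text{ real},\,w\ne\sigma}y_wz_w+\sum_{w\text{ complex}}2\,\mathrm{Re}(y_wz_w),$$ so that $\mathrm{Tr}(\alpha\beta)=\sigma(\alpha)\sigma(\beta)+\langle\alpha',\beta'\rangle$ for $\alpha,\beta\in K$, and let $dy$ be the Minkowski measure (Lebesgue measure at the real places, twice Lebesgue measure at the complex places). Let $\mathfrak A$ be a nonzero fractional ideal of $\mathcal O_K$, with discriminant $\mathrm{disc}(\mathfrak A)$ (the discriminant of a $\mathbb Z$-basis) and trace dual $\mathfrak A^\vee=\{\xi\in K:\mathrm{Tr}(\xi\mathfrak A)\subset\mathbb Z\}$. Let $u\in\mathcal O_K^\times$ be a unit with $|u|_w<1$ for all archimedean places $w\neq\sigma$. Let $D\subset K_{\sigma'}$ be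 a window $D=\prod_{w\ne\sigma}\{y_w:|y_w|<_w|u|_w^{x_w}\}$, where the $x_w$ are real numbers and each $<_w$ is either $<$ or $\le$. For a lattice $\Gamma\subset K$ and a set $E\subset K_{\sigma'}$ write $\mathcal M(\Gamma,E)=\{\alpha\in\Gamma:\alpha'\in E\}$, regarded as a subset of $\mathbb R$ through $\sigma$. Let $\mathfrak m=\mathcal M(\mathfrak A,D)$. Let $f$ be an even Schwartz function on $K_{\sigma'}$ that vanishes outside $D$. Put $\chi(\alpha)=f(\alpha')$ and $\chi^\vee(\xi)=f^\vee(\xi')$, where $$f^\vee(\eta)=\frac1{2\pi}\int_{K_{\sigma'}}f(y)\,e^{-2\pi i\langle y,\eta\rangle}\,dy .$$ Let $D^\vee=\frac{\pi}{3}\{z:|\langle z,y\rangle|\le1\ \ \forall y\in D\}$ and $\mathfrak m_n^\vee=\mathcal M(\mathfrak A^\vee,nD^\vee)$. Let $\Delta\mathfrak m_1^\vee=\mathfrak m_1^\vee$ and $\Delta\mathfrak m_n^\vee=\mathfrak m_n^\vee\setminus\mathfrak m_{n-1}^\vee$ for $n\ge2$. For $\mathrm{Re}(s)>1$ put $$L(\mathfrak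 m,\chi,s)=\sum_{0<\alpha\in\mathfrak m}\frac{\chi(\alpha)}{\alpha^s},\qquad L_n^\vee(\mathfrak m,\chi,s)=\sum_{0<\beta\in\Delta\mathfrak m_n^\vee}\frac{\chi^\vee(\beta)}{\beta^s},\qquad L^\vee(\mathfrak m,\chi,s)=\sum_{n\ge1}L_n^\vee(\mathfrak m,\chi,s),$$ and let $\Lambda(\mathfrak m,\chi,s)$, $\Lambda^\vee(\mathfrak m,\chi,s)$ be the products of $L(\mathfrak m,\chi,s)$, $L^\vee(\mathfrak m,\chi,s)$ with $\pi^{-s/2}\Gamma(s/2)$. Then all these series converge absolutely for $\mathrm{Re}(s)>1$. The functions $\Lambda(\mathfrak m,\chi,s)$ and $\Lambda^\vee(\mathfrak m,\chi,s)$ extend meromorphically to $\mathbb C$ and are holomorphic on $\mathbb C\setminus\{0,1\}$. The function $\Lambda(\mathfrak m,\chi,s)$ has at most simple poles at $s=0$ and $s=1$, with residues $-\chi(0)$ and $2\pi\chi^\vee(0)/\sqrt{|\mathrm{disc}(\mathfrak A)|}$ respectively, and each of these is a genuine simple pole exactly when the given residue is nonzero. Moreover, for all $s\in\mathbb C\setminus\{0,1\}$,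 $$\Lambda(\mathfrak m,\chi,s)=\frac{2\pi}{\sqrt{|\mathrm{disc}(\mathfrak A)|}}\;\Lambda^\vee(\mathfrak m,\chi,1-s).$$ -/

import Mathlib

open NumberField
open scoped nonZeroDivisors Topology Classical

namespace Quasicrystal

noncomputable section

open scoped Pointwise

variable {K : Type*} [Field K] [NumberField K]

/-- A real place of `K`, i.e. an embedding `K → ℝ`. -/
abbrev RealPlace (K : Type*) [Field K] : Type _ := {w : InfinitePlace K // w.IsReal}

/-- A complex place of `K`, i.e. a pair of conjugate non-real embeddings. -/
abbrev ComplexPlace (K : Type*) [Field K] : Type _ := {w : InfinitePlace K // w.IsComplex}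

/-- The space `K_{σ'}`: the product of the archimedean completions `ℝ` and `ℂ` of `K` at all
places other than the real place `σ`. -/
abbrev CoSpace (σ : RealPlace K) : Type _ :=
  ({w : RealPlace K // w ≠ σ} → ℝ) × (ComplexPlace K → ℂ)

/-- The embedding `K → K_σ = ℝ`. -/
def emb (σ : RealPlace K) : K →+* ℝ := InfinitePlace.embedding_of_isReal σ.2

/-- The map `α ↦ α' = π'(α)` from `K` to `K_{σ'}`. -/
def conj (σ : RealPlace K) (α : K) : CoSpace σ :=
  (fun w => emb w.1 α, fun w => w.1.embedding α)

/-- The trace form on `K_{σ'}`. For `α, β ∈ K` one has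
`Tr(αβ) = σ(α) σ(β) + tracePairing σ α' β'`. -/
def tracePairing (σ : RealPlace K) (y z : CoSpace σ) : ℝ :=
  ∑ w, y.1 w * z.1 w + ∑ w, 2 * (y.2 w * z.2 w).re

/-- The Fourier transform of a function on `K_{σ'}`,
`f^∨(η) = (1 / 2π) ∫ f(y) exp(-2πi ⟨y, η⟩) dy`, for the trace form `⟨ , ⟩` and the canonical
(Minkowski) measure, which is Lebesgue measure at the real places and twice Lebesgue measure at
the complex ones. -/
def fourierDual (σ : RealPlace K) (f : CoSpace σ → ℂ) (η : CoSpace σ) : ℂ :=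
  (1 / (2 * (Real.pi : ℂ))) * 2 ^ (InfinitePlace.nrComplexPlaces K) *
    ∫ y : CoSpace σ, Complex.exp (-(2 * (Real.pi : ℂ) * Complex.I * (tracePairing σ y η : ℂ))) * f y

/-- The window `D_x^+(u)`: a product of intervals (at the real places) and of discs (at the complex
places) centred at `0`, of radius `|u|_w ^ (x w)` at the place `w ≠ σ`; the factor at `w` is closed
if `w ∈ c` and open otherwise. The values of `x` and `c` at `σ` play no role. -/
def window (σ : RealPlace K) (u : (𝓞 K)ˣ) (x : InfinitePlace K → ℝ) (c : Set (InfinitePlace K)) :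
    Set (CoSpace σ) :=
  {y | (∀ w : {w : RealPlace K // w ≠ σ},
          (w.1.1 ∈ c → |y.1 w| ≤ (w.1.1 ((u : 𝓞 K) : K)) ^ (x w.1.1)) ∧
          (w.1.1 ∉ c → |y.1 w| < (w.1.1 ((u : 𝓞 K) : K)) ^ (x w.1.1))) ∧
       (∀ w : ComplexPlace K,
          (w.1 ∈ c → ‖y.2 w‖ ≤ (w.1 ((u : 𝓞 K) : K)) ^ (x w.1)) ∧
          (w.1 ∉ c → ‖y.2 w‖ < (w.1 ((u : 𝓞 K) : K)) ^ (x w.1)))}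

/-- The model set `M(Γ, D)` of a lattice `Γ ⊆ K` and a window `D`, as a subset of `K`
(identified with its image in `ℝ` under the embedding `σ`). -/
def modelSet (σ : RealPlace K) (Γ : Set K) (D : Set (CoSpace σ)) : Set K :=
  {α | α ∈ Γ ∧ conj σ α ∈ D}

/-- The discriminant of a fractional ideal: the discriminant of any `ℤ`-basis. -/
def disc (A : (FractionalIdeal (𝓞 K)⁰ K)ˣ) : ℚ :=
  Algebra.discr ℚ (basisOfFractionalIdeal K A)

/-- The fractional ideal as a subset of `K`. -/
def lattice (A : (FractionalIdeal (𝓞 K)⁰ K)ˣ) : Set K :=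
  {α | α ∈ (A : FractionalIdeal (𝓞 K)⁰ K)}

/-- The dual lattice for the trace form. -/
def dualLattice (A : (FractionalIdeal (𝓞 K)⁰ K)ˣ) : Set K :=
  {ξ | ∀ α ∈ lattice A, ∃ k : ℤ, Algebra.trace ℚ K (ξ * α) = (k : ℚ)}

/-- The dual window `D^∨ = (π / 3) · {z | |⟨z, y⟩| ≤ 1 for all y ∈ D}`. -/
def dualWindow (σ : RealPlace K) (D : Set (CoSpace σ)) : Set (CoSpace σ) :=
  (Real.pi / 3 : ℝ) • {z | ∀ y ∈ D, |tracePairing σ z y| ≤ 1}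

/-- The dual model sets `M(𝔄^∨, n D^∨)`. -/
def dualModelSet (σ : RealPlace K) (A : (FractionalIdeal (𝓞 K)⁰ K)ˣ) (D : Set (CoSpace σ))
    (n : ℕ) : Set K :=
  modelSet σ (dualLattice A) ((n : ℝ) • dualWindow σ D)

/-- The sets `Δ𝔪_n^∨`, for `n ≥ 1`: `Δ𝔪_1^∨ = 𝔪_1^∨` and `Δ𝔪_n^∨ = 𝔪_n^∨ ∖ 𝔪_{n-1}^∨` for
`n ≥ 2`. (The index `0` is not used.) -/
def dualShell (σ : RealPlace K) (A : (FractionalIdeal (𝓞 K)⁰ K)ˣ) (D : Set (CoSpace σ)) :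
    ℕ → Set K
  | 0 => ∅
  | 1 => dualModelSet σ A D 1
  | (n + 2) => dualModelSet σ A D (n + 2) \ dualModelSet σ A D (n + 1)

/-- The weight `χ_f(α) = f(α')`. -/
def weight (σ : RealPlace K) (f : CoSpace σ → ℂ) (α : K) : ℂ := f (conj σ α)

/-- The dual weight `χ^∨(ξ) = f^∨(ξ')`. -/
def dualWeight (σ : RealPlace K) (f : CoSpace σ → ℂ) (ξ : K) : ℂ :=
  fourierDual σ f (conj σ ξ)

/-- The positive elements of `X ⊆ K`, for the embedding `σ`. -/
def positives (σ : RealPlace K) (X : Set K) : Set K := {α | α ∈ X ∧ 0 < emb σ α}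

/-- The general term `χ(α) / α^s`. -/
def lTerm (σ : RealPlace K) (χ : K → ℂ) (s : ℂ) (α : K) : ℂ :=
  χ α / ((emb σ α : ℝ) : ℂ) ^ s

/-- `L(X, χ, s) = ∑_{0 < α ∈ X} χ(α) / α^s`. -/
def lSeries (σ : RealPlace K) (X : Set K) (χ : K → ℂ) (s : ℂ) : ℂ :=
  ∑' α : positives σ X, lTerm σ χ s α

/-- `L_n^∨(𝔪, χ_f, s) = L(Δ𝔪_n^∨, χ^∨, s)`. -/
def dualLSeriesLevel (σ : RealPlace K) (A : (FractionalIdeal (𝓞 K)⁰ K)ˣ) (D : Set (CoSpace σ))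
    (f : CoSpace σ → ℂ) (n : ℕ) (s : ℂ) : ℂ :=
  lSeries σ (dualShell σ A D n) (dualWeight σ f) s

/-- `L^∨(𝔪, χ_f, s) = ∑_{n ≥ 1} L_n^∨(𝔪, χ_f, s)`. -/
def dualLSeries (σ : RealPlace K) (A : (FractionalIdeal (𝓞 K)⁰ K)ˣ) (D : Set (CoSpace σ))
    (f : CoSpace σ → ℂ) (s : ℂ) : ℂ :=
  ∑' n : ℕ, dualLSeriesLevel σ A D f (n + 1) s

/-- The factor `π^{-s/2} Γ(s/2)`. -/
def gammaFactor (s : ℂ) : ℂ := (Real.pi : ℂ) ^ (-s / 2) * Complex.Gamma (s / 2)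

/-- `Λ(𝔪, χ_f, s)` for `𝔪 = M(𝔄, D)`, in its domain of convergence `Re s > 1`. -/
def completedL (σ : RealPlace K) (A : (FractionalIdeal (𝓞 K)⁰ K)ˣ) (D : Set (CoSpace σ))
    (f : CoSpace σ → ℂ) (s : ℂ) : ℂ :=
  gammaFactor s * lSeries σ (modelSet σ (lattice A) D) (weight σ f) s

/-- `Λ^∨(𝔪, χ_f, s)` for `𝔪 = M(𝔄, D)`, in its domain of convergence `Re s > 1`. -/
def completedDualL (σ : RealPlace K) (A : (FractionalIdeal (𝓞 K)⁰ K)ˣ) (D : Set (CoSpace σ))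
    (f : CoSpace σ → ℂ) (s : ℂ) : ℂ :=
  gammaFactor s * dualLSeries σ A D f s

/-- The constant `2π / √|disc 𝔄|`. -/
def discConst (A : (FractionalIdeal (𝓞 K)⁰ K)ˣ) : ℝ :=
  2 * Real.pi / Real.sqrt |((disc A : ℚ) : ℝ)|

/-- `F` has at `a` at most a simple pole, with residue `ρ`; the pole is there exactly when
`ρ ≠ 0`. -/
def HasSimplePole (F : ℂ → ℂ) (a ρ : ℂ) : Prop :=
  MeromorphicAt F a ∧ -1 ≤ meromorphicOrderAt F a ∧ (meromorphicOrderAt F a = -1 ↔ ρ ≠ 0) ∧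
    Filter.Tendsto (fun s => (s - a) * F s) (𝓝[≠] a) (𝓝 ρ)

end

end Quasicrystal

/-! Attach to a rapidly decaying `h` on `K_{σ'}` the theta series `θ(τ) = ∑ exp(-πτ σ(α)²) h(α')`
over a lattice in `K`. Embedded in `ℝ × K_{σ'}`, the ideal is a full lattice. Its dual for the trace
form is `𝔄^∨`, and its Lebesgue covolume is `2^{-r₂} √|disc 𝔄|`. Poisson summation for Gaussian ⊗
`f` therefore relates `θ` of `f` at `1/τ` to `τ^{1/2}` times `θ` of `f^∨` at `τ` (`theta_one_div`).
The power of two cancels against the Minkowski measure in `f^∨`, and the constant is `2π / √|disc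
𝔄|`.

Riemann's argument then applies. The Mellin transform at `s/2` of `θ` minus its constant term is
twice the completed series, the two coming from `α ↦ -α`. Mathlib's `WeakFEPair` supplies
continuation, poles and functional equation (`thetaPair`).

The obstacle is that for degree above one `σ(𝔄)` is dense in `ℝ`, so neither the convergence of the
series nor the decay of `θ(τ) - h(0)` is automatic. Both come from the norm: a nonzero `α` satisfies
`|σ(α)| (1 + ‖α'‖)^d ≥ c` (`exists_le_abs_emb_mul`), so a small `σ(α)` forces a large `α'`, where
`h` is tiny. This gives `∑ ‖h(α')‖ / |σ(α)|^s < ∞` for `s > 1` (`summable_norm_div_rpow`), and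
taking `s = 2k` gives decay of every polynomial order (`theta_sub_isBigO`).

The window enters only at the end. As `f` vanishes off `D`, the sum over the model set is the sum
over the ideal. As `D` is bounded, the dilates of `D^∨` exhaust `K_{σ'}`, so the shells partition
`𝔄^∨` and the sum over `n` only rearranges an absolutely convergent series. -/

namespace Quasicrystal

/-! ### Poisson summation for functions with a slowly varying integrable majorant -/

section LatticeSums

open MeasureTheory Set

/-- A weight whose values at points at bounded distance are comparable. -/
def SlowlyVarying {E : Type*} [NormedAddCommGroup E] (Φ : E → ℝ) : Prop :=
  ∀ R : ℝ, ∃ C : ℝ, 0 ≤ C ∧ ∀ x y : E, ‖y‖ ≤ R → Φ x ≤ C * Φ (x + y)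

/-- An integer vector, as a real vector. -/
def intVec {ι : Type*} (n : ι → ℤ) : ι → ℝ := fun i => n i

lemma isOpenQuotientMap_torus {ι : Type*} :
    IsOpenQuotientMap (fun (x : ι → ℝ) (i : ι) => (x i : UnitAddCircle)) :=
  IsOpenQuotientMap.piMap fun _ => QuotientAddGroup.isOpenQuotientMap_mk

lemma exists_intVec_of_coe_eq {ι : Type*} {x y : ι → ℝ} (h : ∀ i, (x i : UnitAddCircle) = y i) :
    ∃ n : ι → ℤ, y = x + intVec n := by
  have : ∀ i, ∃ n : ℤ, y i = x i + n := fun i => by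
    obtain ⟨n, hn⟩ := AddSubgroup.mem_zmultiples_iff.1 (QuotientAddGroup.eq.1 (h i))
    refine ⟨n, ?_⟩
    simp only [zsmul_eq_mul, mul_one] at hn
    rw [hn]; ring
  choose n hn using this
  exact ⟨n, funext hn⟩

/-- The half-open unit cube. -/
def unitBox (ι : Type*) : Set (ι → ℝ) :=
  {x | ∀ i, x i ∈ Ioc ((0 : ι → ℝ) i) ((0 : ι → ℝ) i + 1)}

variable {ι : Type*} [Fintype ι]

lemma measurableSet_unitBox : MeasurableSet (unitBox ι) :=
  MeasurableSet.univ_pi' fun _ => measurableSet_Ioc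

lemma volume_unitBox : volume (unitBox ι) = 1 := by
  have : unitBox ι = Set.pi univ fun _ => Ioc (0 : ℝ) 1 := by
    ext x; simp [unitBox]
  rw [this, volume_pi_pi]; simp

lemma norm_le_one_of_mem_unitBox {x : ι → ℝ} (hx : x ∈ unitBox ι) : ‖x‖ ≤ 1 := by
  refine (pi_norm_le_iff_of_nonneg zero_le_one).2 fun i => ?_
  have := hx i
  simp only [Pi.zero_apply, zero_add, mem_Ioc] at this
  rw [Real.norm_of_nonneg this.1.le]; exact this.2

lemma hasSum_integral_unitBox {F : Type*} [NormedAddCommGroup F] [NormedSpace ℝ F]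
    {g : (ι → ℝ) → F} (hg : Integrable g) :
    HasSum (fun n : ι → ℤ => ∫ x in unitBox ι, g (x + intVec n)) (∫ x, g x) := by
  let s : (ι → ℤ) → Set (ι → ℝ) := fun n => {x | ∀ i, x i ∈ Ioc (n i : ℝ) (n i + 1)}
  have hs : ∀ n, MeasurableSet (s n) := fun n => MeasurableSet.univ_pi' fun _ => measurableSet_Ioc
  have hmem : ∀ n x, x ∈ s n ↔ ∀ i, ⌈x i⌉ - 1 = n i := fun n x => by
    refine forall_congr' fun i => ?_
    rw [sub_eq_iff_eq_add, Int.ceil_eq_iff]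
    simp
  have hd : Pairwise (Function.onFun Disjoint s) := fun n m hnm => by
    refine disjoint_left.2 fun x hx hx' => hnm (funext fun i => ?_)
    rw [← (hmem n x).1 hx i, (hmem m x).1 hx' i]
  have hU : ⋃ n, s n = univ := eq_univ_of_forall fun x =>
    mem_iUnion.2 ⟨fun i => ⌈x i⌉ - 1, (hmem _ _).2 fun i => rfl⟩
  have h := hasSum_integral_iUnion hs hd (hg.integrableOn (s := ⋃ n, s n))
  rw [hU, setIntegral_univ] at h
  refine h.congr_fun fun n => ?_
  have hp := measurePreserving_add_right (volume : Measure (ι → ℝ)) (intVec n)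
  rw [← hp.setIntegral_preimage_emb (measurableEmbedding_addRight _) g (s n)]
  congr 2
  ext x
  simp only [s, unitBox, intVec, mem_preimage, mem_ofPred_eq, mem_Ioc, Pi.add_apply, Pi.zero_apply,
    zero_add]
  refine forall_congr' fun i => ?_
  constructor <;> rintro ⟨h1, h2⟩ <;> constructor <;> linarith

/-- The value at a lattice point is at most a constant times the integral over the adjacent unit
box, and these integrals add up to `∫ Φ`. -/
lemma summable_of_slowlyVarying {Φ : (ι → ℝ) → ℝ} (hi : Integrable Φ) (h0 : ∀ x, 0 ≤ Φ x)
    (hs : SlowlyVarying Φ) : Summable fun n : ι → ℤ => Φ (intVec n) := by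
  obtain ⟨C, hC, h⟩ := hs 1
  refine Summable.of_nonneg_of_le (fun n => h0 _) (fun n => ?_)
    ((hasSum_integral_unitBox hi).summable.mul_left C)
  have hint : IntegrableOn (fun x => C * Φ (x + intVec n)) (unitBox ι) :=
    ((hi.comp_add_right (intVec n)).const_mul C).integrableOn
  rw [← integral_const_mul]
  have h1 : Φ (intVec n) = ∫ _ in unitBox ι, Φ (intVec n) := by
    simp [measureReal_def, volume_unitBox]
  rw [h1]
  refine setIntegral_mono_on ?_ hint measurableSet_unitBox fun x hx => ?_
  · exact integrableOn_const (by simp [volume_unitBox])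
  · rw [add_comm x]
    exact h _ _ (norm_le_one_of_mem_unitBox hx)

lemma mFourier_coe (m : ι → ℤ) (x : ι → ℝ) :
    UnitAddTorus.mFourier m (fun i => (x i : UnitAddCircle)) =
      Complex.exp (2 * Real.pi * Complex.I * (∑ i, (m i : ℝ) * x i : ℝ)) := by
  simp only [UnitAddTorus.mFourier, ContinuousMap.coe_mk, fourier_coe_apply]
  rw [← Complex.exp_sum]
  congr 1
  push_cast
  rw [Finset.mul_sum]
  refine Finset.sum_congr rfl fun i _ => ?_
  simp; ring

/-- The periodization of `g` descends to a continuous function on the torus. Unfolding identifies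
its Fourier coefficients with the Fourier transform of `g` at integer vectors. These are summable,
so the Fourier series converges pointwise and can be evaluated at the origin. -/
theorem poisson_summation_pi {g : C(ι → ℝ, ℂ)} {Φ : (ι → ℝ) → ℝ} (hi : Integrable Φ)
    (hs : SlowlyVarying Φ) (hg : ∀ x, ‖g x‖ ≤ Φ x)
    (hsum : Summable fun m : ι → ℤ =>
      ∫ x, Complex.exp (-(2 * Real.pi * Complex.I * (∑ i, (m i : ℝ) * x i : ℝ))) * g x) :
    ∑' n : ι → ℤ, g (intVec n) = ∑' m : ι → ℤ,
      ∫ x, Complex.exp (-(2 * Real.pi * Complex.I * (∑ i, (m i : ℝ) * x i : ℝ))) * g x := by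
  have h0 : ∀ x, 0 ≤ Φ x := fun x => (norm_nonneg _).trans (hg x)
  have hgi : Integrable g := hi.mono' g.continuous.aestronglyMeasurable (.of_forall hg)
  -- On a compact set of radius `R`, shifting back by `-x` bounds the translate by `C * Φ (intVec
  -- n)` uniformly in `x`.
  have hloc : ∀ S : TopologicalSpace.Compacts (ι → ℝ), Summable fun n : ι → ℤ =>
      ‖(g.comp (ContinuousMap.addRight (intVec n))).restrict S‖ := fun S => by
    obtain ⟨R, hR⟩ := S.isCompact.isBounded.exists_norm_le
    obtain ⟨C, hC, h⟩ := hs R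
    refine Summable.of_nonneg_of_le (fun n => norm_nonneg _) (fun n => ?_)
      ((summable_of_slowlyVarying hi h0 hs).mul_left C)
    refine (ContinuousMap.norm_le _ (mul_nonneg hC (h0 _))).2 fun x => ?_
    have := h (x.1 + intVec n) (-x.1) (by simpa using hR x.1 x.2)
    rw [add_comm x.1, add_neg_cancel_right] at this
    have h2 := (hg (intVec n + x.1)).trans this
    rw [add_comm] at h2
    exact h2
  have hS := ContinuousMap.summable_of_locally_summable_norm hloc
  let G : C(ι → ℝ, ℂ) := ∑' n : ι → ℤ, g.comp (ContinuousMap.addRight (intVec n))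
  have hG : ∀ x, G x = ∑' n : ι → ℤ, g (x + intVec n) := fun x => by
    exact (ContinuousMap.tsum_apply hS x).symm
  have hper : ∀ x m, G (x + intVec m) = G x := fun x m => by
    rw [hG, hG, ← (Equiv.addLeft m).tsum_eq (fun n => g (x + intVec n))]
    refine tsum_congr fun n => ?_
    congr 1
    ext i
    simp [intVec, add_assoc]
  let p : C(ι → ℝ, UnitAddTorus ι) := ⟨_, isOpenQuotientMap_torus.continuous⟩
  have hp : Topology.IsQuotientMap p := isOpenQuotientMap_torus.isQuotientMap
  have hfac : Function.FactorsThrough G p := fun x y hxy => by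
    obtain ⟨n, rfl⟩ := exists_intVec_of_coe_eq fun i => congrFun hxy i
    exact (hper _ _).symm
  let F : C(UnitAddTorus ι, ℂ) := hp.lift G hfac
  have hF : ∀ x : ι → ℝ, F (fun i => (x i : UnitAddCircle)) = G x := fun x =>
    DFunLike.congr_fun (hp.lift_comp G hfac) x
  have hcoeff : ∀ m : ι → ℤ, UnitAddTorus.mFourierCoeff F m =
      ∫ x, Complex.exp (-(2 * Real.pi * Complex.I * (∑ i, (m i : ℝ) * x i : ℝ))) * g x := by
    intro m
    rw [UnitAddTorus.mFourierCoeff_eq_integral _ _ 0]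
    -- `unitBox` is spelled exactly as the integration domain with base point `0`.
    change ∫ x in unitBox ι, _ = _
    have he : ∀ x : ι → ℝ, UnitAddTorus.mFourier (-m) (fun i => (x i : UnitAddCircle)) =
        Complex.exp (-(2 * Real.pi * Complex.I * (∑ i, (m i : ℝ) * x i : ℝ))) := fun x => by
      rw [mFourier_coe]
      congr 1
      simp
    have hper' : ∀ (x : ι → ℝ) (n : ι → ℤ),
        UnitAddTorus.mFourier (-m) (fun i => ((x + intVec n) i : UnitAddCircle)) =
        UnitAddTorus.mFourier (-m) (fun i => (x i : UnitAddCircle)) := fun x n => by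
      congr 1
      ext i
      simp only [Pi.add_apply, intVec]
      rw [AddCircle.coe_add]
      simp
    let e : (ι → ℝ) → ℂ := fun x => UnitAddTorus.mFourier (-m) (fun i => (x i : UnitAddCircle)) * g x
    have hen : ∀ x, ‖e x‖ = ‖g x‖ := fun x => by
      simp only [e, norm_mul, he]
      rw [Complex.norm_exp]; simp
    have hec : Continuous e := ((UnitAddTorus.mFourier (-m)).continuous.comp
      isOpenQuotientMap_torus.continuous).mul g.continuous
    have hei : Integrable e := hgi.norm.mono' hec.aestronglyMeasurable (.of_forall fun x => (hen x).le)
    have h1 := hasSum_integral_unitBox hei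
    -- Sum and integral may be interchanged because the integrals of the norms over the box add up
    -- to `∫ ‖e‖`.
    have h2 := hasSum_integral_of_summable_integral_norm (μ := volume.restrict (unitBox ι))
      (F := fun (n : ι → ℤ) x => e (x + intVec n)) (fun n => (hei.comp_add_right _).integrableOn)
      (hasSum_integral_unitBox hei.norm).summable
    simp_rw [← he]
    refine Eq.trans ?_ (h1.unique h2).symm
    refine integral_congr_ae (.of_forall fun x => ?_)
    simp only [e, hper', tsum_mul_left, hF, hG, smul_eq_mul]
  have hsum' : Summable (UnitAddTorus.mFourierCoeff F) := by
    convert! hsum using 1; exact funext hcoeff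
  have := (UnitAddTorus.hasSum_mFourier_series_apply_of_summable hsum'
    (fun i => (((0 : ι → ℝ) i : ℝ) : UnitAddCircle))).tsum_eq
  rw [hF, hG] at this
  simp only [mFourier_coe, hcoeff] at this
  simpa using this.symm

variable {E : Type*} [NormedAddCommGroup E] [NormedSpace ℝ E]

lemma SlowlyVarying.comp_clm {F : Type*} [NormedAddCommGroup F] [NormedSpace ℝ F] {Φ : E → ℝ}
    (hs : SlowlyVarying Φ) (T : F →L[ℝ] E) : SlowlyVarying fun x => Φ (T x) := fun R => by
  obtain ⟨C, hC, h⟩ := hs (‖T‖ * R)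
  refine ⟨C, hC, fun x y hy => ?_⟩
  simp only [map_add]
  exact h _ _ ((T.le_opNorm y).trans (by gcongr))

lemma equivFunL_symm_apply (B : Module.Basis ι ℝ E) (x : ι → ℝ) :
    B.equivFunL.symm x = ∑ i, x i • B i :=
  B.equivFun_symm_apply x

lemma SlowlyVarying.comp_basis {Φ : E → ℝ} (hs : SlowlyVarying Φ)
    (B : Module.Basis ι ℝ E) :
    SlowlyVarying fun x : ι → ℝ => Φ (∑ i, x i • B i) := by
  have := hs.comp_clm (B.equivFunL.symm : (ι → ℝ) →L[ℝ] E)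
  simpa [equivFunL_symm_apply] using this

variable [MeasurableSpace E] [BorelSpace E] (μ : Measure E) [μ.IsAddHaarMeasure]
  (B : Module.Basis ι ℝ E)

lemma measurableEmbedding_equivFunL_symm : MeasurableEmbedding B.equivFunL.symm :=
  B.equivFunL.symm.toHomeomorph.measurableEmbedding

lemma measure_fundamentalDomain_ne_top : μ (ZSpan.fundamentalDomain B) ≠ ⊤ := by
  have : FiniteDimensional ℝ E := B.finiteDimensional_of_finite
  have := FiniteDimensional.proper ℝ E
  exact (ZSpan.fundamentalDomain_isBounded B).measure_lt_top.ne

/-- Haar measure is unique up to a scalar, which is read off on the fundamental domain: in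
coordinates it is the unit cube. -/
lemma map_basis_volume :
    μ = μ (ZSpan.fundamentalDomain B) • Measure.map B.equivFunL.symm volume := by
  have : FiniteDimensional ℝ E := B.finiteDimensional_of_finite
  have hH : (Measure.map B.equivFunL.symm (volume : Measure (ι → ℝ))).IsAddHaarMeasure :=
    B.equivFunL.symm.isAddHaarMeasure_map _
  have h := Measure.isAddLeftInvariant_eq_smul μ
    (Measure.map B.equivFunL.symm (volume : Measure (ι → ℝ)))
  set c := μ.addHaarScalarFactor (Measure.map B.equivFunL.symm (volume : Measure (ι → ℝ)))
  have h1 : Measure.map B.equivFunL.symm (volume : Measure (ι → ℝ))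
      (ZSpan.fundamentalDomain B) = 1 := by
    rw [Measure.map_apply B.equivFunL.symm.continuous.measurable
      (ZSpan.fundamentalDomain_measurableSet B)]
    have : B.equivFunL.symm ⁻¹' (ZSpan.fundamentalDomain B) =
        Set.pi univ fun _ => Ico (0 : ℝ) 1 := by
      ext x
      simp [ZSpan.mem_fundamentalDomain, equivFunL_symm_apply, -map_sum, B.repr_sum_self]
    rw [this, volume_pi_pi]
    simp
  have h2 : μ (ZSpan.fundamentalDomain B) = c := by
    conv_lhs => rw [h]
    rw [Measure.smul_apply, h1]
    simp [ENNReal.smul_def]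
  rw [h2]
  exact h

lemma integral_eq_integral_basis {F : Type*} [NormedAddCommGroup F] [NormedSpace ℝ F] (g : E → F) :
    ∫ v, g v ∂μ = μ.real (ZSpan.fundamentalDomain B) • ∫ x : ι → ℝ, g (∑ i, x i • B i) := by
  conv_lhs => rw [map_basis_volume μ B]
  rw [integral_smul_measure, (measurableEmbedding_equivFunL_symm B).integral_map]
  simp [measureReal_def, equivFunL_symm_apply]

lemma integrable_comp_basis {F : Type*} [NormedAddCommGroup F] {g : E → F}
    (hg : Integrable g μ) : Integrable fun x : ι → ℝ => g (∑ i, x i • B i) := by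
  rw [map_basis_volume μ B] at hg
  have h0 : μ (ZSpan.fundamentalDomain B) ≠ 0 := ZSpan.measure_fundamentalDomain_ne_zero B
  rw [integrable_smul_measure h0 (measure_fundamentalDomain_ne_top μ B),
    (measurableEmbedding_equivFunL_symm B).integrable_map_iff] at hg
  simpa [Function.comp_def, equivFunL_symm_apply] using hg

lemma summable_basis_of_slowlyVarying {Φ : E → ℝ} (hi : Integrable Φ μ) (h0 : ∀ x, 0 ≤ Φ x)
    (hs : SlowlyVarying Φ) : Summable fun n : ι → ℤ => Φ (∑ i, (n i : ℝ) • B i) :=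
  summable_of_slowlyVarying (integrable_comp_basis μ B hi) (fun _ => h0 _) (hs.comp_basis B)

theorem poisson_summation_basis {g : E → ℂ} (hgc : Continuous g) {Φ : E → ℝ}
    (hi : Integrable Φ μ) (hs : SlowlyVarying Φ) (hg : ∀ x, ‖g x‖ ≤ Φ x)
    (hsum : Summable fun m : ι → ℤ => ∫ v,
      Complex.exp (-(2 * Real.pi * Complex.I * (∑ i, (m i : ℝ) * B.repr v i : ℝ))) * g v ∂μ) :
    ∑' n : ι → ℤ, g (∑ i, (n i : ℝ) • B i) = (μ.real (ZSpan.fundamentalDomain B) : ℂ)⁻¹ *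
      ∑' m : ι → ℤ, ∫ v,
        Complex.exp (-(2 * Real.pi * Complex.I * (∑ i, (m i : ℝ) * B.repr v i : ℝ))) * g v ∂μ := by
  have h0 : μ.real (ZSpan.fundamentalDomain B) ≠ 0 :=
    (measureReal_ne_zero_iff (measure_fundamentalDomain_ne_top μ B)).2
      (ZSpan.measure_fundamentalDomain_ne_zero B)
  have h1 : ∀ m : ι → ℤ, ∫ v, Complex.exp (-(2 * Real.pi * Complex.I *
      (∑ i, (m i : ℝ) * B.repr v i : ℝ))) * g v ∂μ =
      (μ.real (ZSpan.fundamentalDomain B) : ℂ) * ∫ x : ι → ℝ, Complex.exp (-(2 * Real.pi *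
        Complex.I * (∑ i, (m i : ℝ) * x i : ℝ))) * g (∑ i, x i • B i) := fun m => by
    rw [integral_eq_integral_basis μ B, Complex.real_smul]
    congr 2
    ext x
    rw [B.repr_sum_self]
  simp only [h1] at hsum ⊢
  have h0' : (μ.real (ZSpan.fundamentalDomain B) : ℂ) ≠ 0 := by exact_mod_cast h0
  rw [tsum_mul_left, inv_mul_cancel_left₀ h0']
  have hc : Continuous fun x : ι → ℝ => g (∑ i, x i • B i) := hgc.comp (by fun_prop)
  exact poisson_summation_pi (g := ⟨_, hc⟩) (integrable_comp_basis μ B hi) (hs.comp_basis B)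
    (fun _ => hg _) ((summable_mul_left_iff h0').1 hsum)

end LatticeSums

end Quasicrystal

/-! ### The lattice in `K_σ × K_{σ'}` and its trace dual -/

namespace Quasicrystal

noncomputable section Ambient

open MeasureTheory

variable {K : Type*} [Field K] [NumberField K] (σ : RealPlace K)

/-- The space `K_σ × K_{σ'}`. -/
abbrev Ambient (σ : RealPlace K) : Type _ := ℝ × CoSpace σ

/-- The embedding of `K` in `K_σ × K_{σ'}`. -/
def toAmbient : K →+ Ambient σ where
  toFun α := (emb σ α, conj σ α)
  map_zero' := Prod.ext (map_zero _) (Prod.ext (funext fun _ => map_zero _) (funext fun _ => map_zero _))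
  map_add' _ _ := Prod.ext (map_add _ _ _) (Prod.ext (funext fun _ => map_add _ _ _)
    (funext fun _ => map_add _ _ _))

@[simp] lemma toAmbient_fst (α : K) : (toAmbient σ α).1 = emb σ α := rfl
@[simp] lemma toAmbient_snd (α : K) : (toAmbient σ α).2 = conj σ α := rfl

lemma conj_neg (α : K) : conj σ (-α) = -conj σ α :=
  congrArg Prod.snd (map_neg (toAmbient σ) α)

/-- The trace form on `K_σ × K_{σ'}`. -/
def ambientPairing (v w : Ambient σ) : ℝ := v.1 * w.1 + tracePairing σ v.2 w.2

lemma tracePairing_add_left (y y' z : CoSpace σ) :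
    tracePairing σ (y + y') z = tracePairing σ y z + tracePairing σ y' z := by
  simp only [tracePairing, Prod.fst_add, Prod.snd_add, Pi.add_apply, add_mul, mul_add,
    Complex.add_re, Finset.sum_add_distrib]
  ring

lemma tracePairing_smul_left (r : ℝ) (y z : CoSpace σ) :
    tracePairing σ (r • y) z = r * tracePairing σ y z := by
  simp only [tracePairing, Prod.smul_fst, Prod.smul_snd, Pi.smul_apply, smul_eq_mul, mul_add,
    Finset.mul_sum, Complex.real_smul, mul_assoc, Complex.re_ofReal_mul]
  congr 1
  refine Finset.sum_congr rfl fun w _ => by ring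

lemma tracePairing_comm (y z : CoSpace σ) : tracePairing σ y z = tracePairing σ z y := by
  simp only [tracePairing, mul_comm]

/-- The trace form on `K_{σ'}` as a continuous bilinear map. -/
def traceBilin : CoSpace σ →L[ℝ] CoSpace σ →L[ℝ] ℝ :=
  LinearMap.toContinuousLinearMap
    (LinearMap.toContinuousLinearMap.toLinearMap ∘ₗ
      LinearMap.mk₂ ℝ (tracePairing σ) (tracePairing_add_left σ) (tracePairing_smul_left σ)
        (fun y z z' => by simp only [tracePairing_comm σ y, tracePairing_add_left])
        (fun r y z => by simp only [tracePairing_comm σ y, tracePairing_smul_left, smul_eq_mul]))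

@[simp] lemma traceBilin_apply (y z : CoSpace σ) : traceBilin σ y z = tracePairing σ y z := rfl

/-- The trace form on `K_σ × K_{σ'}` in its first variable. -/
def ambientForm (w : Ambient σ) : Ambient σ →ₗ[ℝ] ℝ where
  toFun v := ambientPairing σ v w
  map_add' v v' := by simp [ambientPairing, tracePairing_add_left]; ring
  map_smul' r v := by simp [ambientPairing, tracePairing_smul_left]; ring

lemma emb_coe (w : RealPlace K) (α : K) : ((emb w α : ℝ) : ℂ) = w.1.embedding α :=
  InfinitePlace.embedding_of_isReal_apply w.2 α

lemma abs_emb (w : RealPlace K) (α : K) : |emb w α| = w.1 α :=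
  InfinitePlace.norm_embedding_of_isReal w.2 α

/-- The trace is the sum over complex embeddings; grouped by place, conjugate embeddings have equal
real parts. -/
lemma trace_eq_sum_mult (α : K) : ((Algebra.trace ℚ K α : ℚ) : ℝ) =
    ∑ w : InfinitePlace K, (w.mult : ℝ) * (w.embedding α).re := by
  have h : ((Algebra.trace ℚ K α : ℚ) : ℂ) = ∑ φ : K →+* ℂ, φ α := by
    have := trace_eq_sum_embeddings (K := ℚ) (L := K) ℂ (x := α)
    rw [eq_ratCast] at this
    rw [this, ← Fintype.sum_equiv (RingHom.equivRatAlgHom K ℂ) (fun f => f α)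
      (fun φ => φ α) fun _ => by simp [RingHom.equivRatAlgHom_apply]]
  have h' := congrArg Complex.re h
  rw [Complex.re_sum, ← Finset.sum_fiberwise Finset.univ InfinitePlace.mk] at h'
  rw [← Complex.ofReal_ratCast, Complex.ofReal_re] at h'
  rw [h']
  refine Finset.sum_congr rfl fun w _ => ?_
  rw [← InfinitePlace.card_filter_mk_eq w, ← nsmul_eq_mul, ← Finset.sum_const]
  refine Finset.sum_congr rfl fun φ hφ => ?_
  have hw := (Finset.mem_filter.1 hφ).2
  rw [← InfinitePlace.mk_embedding w, InfinitePlace.mk_eq_iff] at hw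
  rcases hw with rfl | hw
  · rfl
  · rw [← hw]; simp [ComplexEmbedding.conjugate]

lemma sum_realPlace {M : Type*} [AddCommMonoid M] (g : RealPlace K → M) :
    ∑ w, g w = g σ + ∑ w : {w : RealPlace K // w ≠ σ}, g w.1 := by
  convert! Fintype.sum_eq_add_sum_subtype_ne g σ

lemma trace_mul_eq_ambientPairing (α β : K) : ((Algebra.trace ℚ K (α * β) : ℚ) : ℝ) =
    ambientPairing σ (toAmbient σ α) (toAmbient σ β) := by
  rw [trace_eq_sum_mult, InfinitePlace.sum_eq_sum_add_sum, ambientPairing, tracePairing,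
    sum_realPlace σ fun w => (w.1.mult : ℝ) * (w.1.embedding (α * β)).re, add_assoc]
  have h : ∀ w : RealPlace K, (w.1.mult : ℝ) * (w.1.embedding (α * β)).re = emb w α * emb w β :=
    fun w => by
      rw [← emb_coe, w.2.mult_eq_one, Complex.ofReal_re, map_mul, Nat.cast_one, one_mul]
  simp only [h, toAmbient_fst, toAmbient_snd, conj]
  congr 2
  refine Finset.sum_congr rfl fun w _ => ?_
  rw [w.2.mult_eq_two, map_mul]
  norm_num

/-- The identification of the mixed space of `K` with `K_σ × K_{σ'}`. -/
def mixedEquiv : mixedEmbedding.mixedSpace K ≃ₗ[ℝ] Ambient σ where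
  toFun x := (x.1 σ, (fun w => x.1 w.1, x.2))
  invFun v := (fun w => if h : w = σ then v.1 else v.2.1 ⟨w, h⟩, v.2.2)
  map_add' _ _ := rfl
  map_smul' _ _ := rfl
  left_inv x := by
    refine Prod.ext (funext fun w => ?_) rfl
    by_cases h : w = σ
    · subst h; simp
    · simp [h]
  right_inv v := by
    refine Prod.ext (by simp) (Prod.ext (funext fun w => ?_) rfl)
    simp [w.2]

lemma mixedEquiv_mixedEmbedding (α : K) :
    mixedEquiv σ (mixedEmbedding K α) = toAmbient σ α := rfl

/-- Splitting off the coordinate `σ` and reassociating products preserve Lebesgue measure. This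
carries the known covolume of ideals in the mixed space over to `Ambient σ`. -/
lemma measurePreserving_mixedEquiv : MeasurePreserving (mixedEquiv σ) := by
  have h1 : MeasurePreserving
      (MeasurableEquiv.piEquivPiSubtypeProd (fun _ : RealPlace K => ℝ) (fun w => w = σ)) volume
      ((volume : Measure ({w : RealPlace K // w = σ} → ℝ)).prod
        (volume : Measure ({w : RealPlace K // w ≠ σ} → ℝ))) := by
    convert! measurePreserving_piEquivPiSubtypeProd
      (fun _ : RealPlace K => (volume : Measure ℝ)) (fun w => w = σ)
    simp only [volume_pi]
    congr!
  have h2 : MeasurePreserving (MeasurableEquiv.funUnique {w : RealPlace K // w = σ} ℝ)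
      (volume : Measure ({w : RealPlace K // w = σ} → ℝ)) volume := by
    convert! volume_preserving_funUnique {w : RealPlace K // w = σ} ℝ
  have h3 := (h2.prod (MeasurePreserving.id
    (volume : Measure ({w : RealPlace K // w ≠ σ} → ℝ)))).comp h1
  have h4 := h3.prod (MeasurePreserving.id (volume : Measure (ComplexPlace K → ℂ)))
  exact volume_preserving_prodAssoc.comp h4

lemma finrank_ambient : Module.finrank ℝ (Ambient σ) = Module.finrank ℚ K := by
  rw [← mixedEmbedding.finrank K, (mixedEquiv σ).finrank_eq]

variable {ι : Type*} [Fintype ι] (b : Module.Basis ι ℚ K)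

/-- The `ℤ`-linear combinations of a `ℚ`-basis of `K`. -/
def latticePoint (n : ι → ℤ) : K := ∑ i, n i • b i

lemma toAmbient_latticePoint (n : ι → ℤ) :
    toAmbient σ (latticePoint b n) = ∑ i, (n i : ℝ) • toAmbient σ (b i) := by
  simp only [latticePoint, map_sum, map_zsmul, Int.cast_smul_eq_zsmul]

lemma ambientPairing_traceDual (i j : ι) :
    ambientPairing σ (toAmbient σ (b i)) (toAmbient σ (b.traceDual j)) = if i = j then 1 else 0 := by
  rw [← trace_mul_eq_ambientPairing, b.trace_mul_traceDual]
  split_ifs <;> simp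

lemma ambientPairing_sum (x : ι → ℝ) (j : ι) :
    ambientPairing σ (∑ i, x i • toAmbient σ (b i)) (toAmbient σ (b.traceDual j)) = x j := by
  change ambientForm σ (toAmbient σ (b.traceDual j)) _ = _
  rw [map_sum]
  simp only [map_smul, smul_eq_mul]
  change ∑ i, x i * ambientPairing σ _ _ = _
  simp [ambientPairing_traceDual]

/-- Pairing with the trace dual basis recovers each real coefficient. -/
lemma linearIndependent_toAmbient : LinearIndependent ℝ fun i => toAmbient σ (b i) := by
  rw [Fintype.linearIndependent_iff]
  intro x hx j
  rw [← ambientPairing_sum σ b x j, hx]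
  simp [ambientPairing, tracePairing]

/-- A `ℚ`-basis of `K`, as a real basis of `K_σ × K_{σ'}`. -/
def ambientBasis : Module.Basis ι ℝ (Ambient σ) :=
  basisOfLinearIndependentOfCardEqFinrank' _ (linearIndependent_toAmbient σ b)
    (by rw [finrank_ambient, Module.finrank_eq_card_basis b])

@[simp] lemma ambientBasis_apply (i : ι) : ambientBasis σ b i = toAmbient σ (b i) := by
  simp [ambientBasis]

lemma ambientBasis_repr (v : Ambient σ) (j : ι) :
    (ambientBasis σ b).repr v j = ambientPairing σ v (toAmbient σ (b.traceDual j)) := by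
  conv_rhs => rw [← (ambientBasis σ b).sum_repr v]
  simp only [ambientBasis_apply, ambientPairing_sum]

lemma ambientPairing_comm (v w : Ambient σ) : ambientPairing σ v w = ambientPairing σ w v := by
  rw [ambientPairing, ambientPairing, tracePairing_comm, mul_comm]

/-- Turns the phase at frequency `m` in Poisson summation into the trace pairing with a point of the
dual lattice. -/
lemma sum_mul_ambientBasis_repr (m : ι → ℤ) (v : Ambient σ) :
    ∑ j, (m j : ℝ) * (ambientBasis σ b).repr v j =
      ambientPairing σ v (toAmbient σ (latticePoint b.traceDual m)) := by
  rw [ambientPairing_comm]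
  change _ = ambientForm σ v _
  rw [toAmbient_latticePoint, map_sum]
  simp only [map_smul, smul_eq_mul, ambientBasis_repr]
  refine Finset.sum_congr rfl fun j _ => ?_
  rw [ambientPairing_comm]; rfl

lemma latticePoint_injective : Function.Injective (latticePoint b) := fun n m h => by
  have h' : ∑ i, (n i : ℚ) • b i = ∑ i, (m i : ℚ) • b i := by
    simpa only [latticePoint, Int.cast_smul_eq_zsmul] using h
  funext i
  have := congrArg (fun v => b.repr v i) h'
  simp only [b.repr_sum_self] at this
  exact_mod_cast this

lemma latticePoint_zero : latticePoint b 0 = 0 := by simp [latticePoint]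

end Ambient

end Quasicrystal

/-! ### Convergence of lattice sums from the norm bound -/

namespace Quasicrystal

noncomputable section Summability

open MeasureTheory

variable {K : Type*} [Field K] [NumberField K] (σ : RealPlace K)

instance isAddHaarMeasure_coSpace : (volume : Measure (CoSpace σ)).IsAddHaarMeasure :=
  Measure.prod.instIsAddHaarMeasure volume volume

instance isAddHaarMeasure_ambient : (volume : Measure (Ambient σ)).IsAddHaarMeasure :=
  Measure.prod.instIsAddHaarMeasure volume volume

lemma place_le_norm_conj {w : InfinitePlace K} (hw : w ≠ σ.1) (α : K) : w α ≤ ‖conj σ α‖ := by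
  rcases w.isReal_or_isComplex with h | h
  · have hne : (⟨w, h⟩ : RealPlace K) ≠ σ := fun e => hw (congrArg Subtype.val e)
    calc w α = ‖(conj σ α).1 ⟨⟨w, h⟩, hne⟩‖ := (abs_emb ⟨w, h⟩ α).symm
      _ ≤ ‖(conj σ α).1‖ := norm_le_pi_norm _ _
      _ ≤ _ := norm_fst_le _
  · calc w α = ‖(conj σ α).2 ⟨w, h⟩‖ := (w.norm_embedding_eq α).symm
      _ ≤ ‖(conj σ α).2‖ := norm_le_pi_norm _ _
      _ ≤ _ := norm_snd_le _

/-- The norm of a nonzero integer has absolute value at least one and is the product of its absolute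
values with multiplicity. Every factor other than `σ` is at most `1 + ‖a'‖`, and the multiplicities
sum to the degree. -/
lemma one_le_abs_emb_mul_integer {a : 𝓞 K} (ha : a ≠ 0) :
    1 ≤ |emb σ (a : K)| * (1 + ‖conj σ (a : K)‖) ^ Module.finrank ℚ K := by
  have h1 : (1 : ℝ) ≤ |Algebra.norm ℚ (a : K)| := by
    rw [← Algebra.coe_norm_int, ← Int.cast_one, ← Int.cast_abs, Rat.cast_intCast, Int.cast_le]
    exact Int.one_le_abs (Algebra.norm_ne_zero_iff.mpr ha)
  have hB : 1 ≤ 1 + ‖conj σ (a : K)‖ := le_add_of_nonneg_right (norm_nonneg _)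
  rw [← InfinitePlace.prod_eq_abs_norm, ← Finset.mul_prod_erase _ _ (Finset.mem_univ σ.1),
    σ.2.mult_eq_one, pow_one, ← abs_emb] at h1
  refine h1.trans (mul_le_mul_of_nonneg_left ?_ (abs_nonneg _))
  calc ∏ w ∈ Finset.univ.erase σ.1, w (a : K) ^ w.mult
      ≤ ∏ w ∈ Finset.univ.erase σ.1, (1 + ‖conj σ (a : K)‖) ^ w.mult := by
        refine Finset.prod_le_prod (fun w _ => by positivity) fun w hw => ?_
        refine pow_le_pow_left₀ (apply_nonneg _ _) ?_ _
        exact (place_le_norm_conj σ (Finset.ne_of_mem_erase hw) _).trans (by linarith)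
    _ = (1 + ‖conj σ (a : K)‖) ^ ∑ w ∈ Finset.univ.erase σ.1, w.mult :=
        Finset.prod_pow_eq_pow_sum _ _ _
    _ ≤ _ := by
        refine pow_le_pow_right₀ hB ?_
        rw [← InfinitePlace.sum_mult_eq]
        exact Finset.sum_le_sum_of_subset (Finset.erase_subset _ _)

variable {ι : Type*} [Fintype ι] (b : Module.Basis ι ℚ K)

lemma conj_nsmul (m : ℕ) (α : K) : conj σ (m • α) = m • conj σ α :=
  congrArg Prod.snd (map_nsmul (toAmbient σ) m α)

/-- On a lattice in `K`, a nonzero element is not small at `σ` unless its conjugates are large. -/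
lemma exists_le_abs_emb_mul : ∃ c : ℝ, 0 < c ∧ ∀ n : ι → ℤ, n ≠ 0 →
    c ≤ |emb σ (latticePoint b n)| *
      (1 + ‖conj σ (latticePoint b n)‖) ^ Module.finrank ℚ K := by
  have : Algebra.IsAlgebraic ℤ K :=
    (IsFractionRing.comap_isAlgebraic_iff (A := ℤ) (K := ℚ) (C := K)).2 inferInstance
  -- A common denominator `y` of the basis makes the whole lattice integral.
  obtain ⟨y, hy0, hy⟩ := Algebra.IsAlgebraic.exists_integral_multiples ℤ
    (Finset.univ.image fun i => b i)
  set m := y.natAbs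
  have hm : 1 ≤ m := Int.natAbs_pos.2 hy0
  set d := Module.finrank ℚ K
  have hm' : (1 : ℝ) ≤ m := by exact_mod_cast hm
  -- One factor `m` comes from `|σ(mα)|`, the power `m ^ d` from `1 + m‖α'‖ ≤ m (1 + ‖α'‖)`.
  refine ⟨((m : ℝ) * (m : ℝ) ^ d)⁻¹, by positivity, fun n hn => ?_⟩
  set α := latticePoint b n
  have hα : α ≠ 0 := fun h => hn (latticePoint_injective b (h.trans (latticePoint_zero b).symm))
  have hint : IsIntegral ℤ (m • α) := by
    have h1 : IsIntegral ℤ (y • α) := by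
      simp only [α, latticePoint, Finset.smul_sum]
      refine IsIntegral.sum _ fun i _ => ?_
      rw [smul_comm]
      exact (hy _ (Finset.mem_image_of_mem _ (Finset.mem_univ i))).smul (n i)
    rcases Int.natAbs_eq y with h | h
    · rw [h, natCast_zsmul] at h1; exact h1
    · rw [h, neg_smul, natCast_zsmul] at h1
      have h2 := h1.neg
      rwa [neg_neg] at h2
  let a : 𝓞 K := ⟨m • α, hint⟩
  have ha : a ≠ 0 := fun h => by
    have h2 : m • α = 0 := congrArg (algebraMap (𝓞 K) K) h
    exact (smul_ne_zero (by omega) hα) h2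
  have h := one_le_abs_emb_mul_integer σ ha
  change 1 ≤ |emb σ (m • α)| * (1 + ‖conj σ (m • α)‖) ^ d at h
  rw [map_nsmul, conj_nsmul, nsmul_eq_mul, abs_mul, Nat.abs_cast,
    ← Nat.cast_smul_eq_nsmul ℝ, norm_smul, Real.norm_natCast] at h
  rw [inv_le_iff_one_le_mul₀' (by positivity)]
  calc 1 ≤ (m : ℝ) * |emb σ α| * (1 + m * ‖conj σ α‖) ^ d := h
    _ ≤ (m : ℝ) * |emb σ α| * (m * (1 + ‖conj σ α‖)) ^ d := by
      gcongr
      rw [mul_add, mul_one]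
      linarith
    _ = _ := by rw [mul_pow]; ring

/-- A function that decays faster than every power of the norm. -/
def RapidDecay {V : Type*} [NormedAddCommGroup V] (h : V → ℂ) : Prop :=
  ∀ N : ℕ, ∃ C : ℝ, 0 ≤ C ∧ ∀ y, (1 + ‖y‖) ^ N * ‖h y‖ ≤ C

lemma slowlyVarying_one_add_norm_rpow {V : Type*} [NormedAddCommGroup V] {s : ℝ} (hs : 0 ≤ s) :
    SlowlyVarying fun x : V => (1 + ‖x‖) ^ (-s) := fun R => by
  -- `|R|` because the bound `R` may be any real number.
  refine ⟨(1 + |R|) ^ s, by positivity, fun x y hy => ?_⟩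
  have h1 : (1 + ‖x + y‖) ≤ (1 + |R|) * (1 + ‖x‖) := by
    have := norm_add_le x y
    have := le_abs_self R
    nlinarith [norm_nonneg x, abs_nonneg R]
  have h2 := Real.rpow_le_rpow (by positivity) h1 hs
  rw [Real.mul_rpow (by positivity) (by positivity)] at h2
  simp only []
  rw [Real.rpow_neg (by positivity), Real.rpow_neg (by positivity), ← div_eq_mul_inv,
    inv_eq_one_div, div_le_div_iff₀ (by positivity) (by positivity), one_mul]
  exact h2

lemma SlowlyVarying.prod {V W : Type*} [NormedAddCommGroup V] [NormedAddCommGroup W]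
    {Φ : V → ℝ} {Ψ : W → ℝ} (hΦ : SlowlyVarying Φ) (hΨ : SlowlyVarying Ψ)
    (hΦ0 : ∀ v, 0 ≤ Φ v) (hΨ0 : ∀ w, 0 ≤ Ψ w) :
    SlowlyVarying fun v : V × W => Φ v.1 * Ψ v.2 := fun R => by
  obtain ⟨C, hC, h⟩ := hΦ R
  obtain ⟨C', hC', h'⟩ := hΨ R
  refine ⟨C * C', mul_nonneg hC hC', fun x y hy => ?_⟩
  calc Φ x.1 * Ψ x.2 ≤ (C * Φ (x.1 + y.1)) * (C' * Ψ (x.2 + y.2)) :=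
        mul_le_mul (h _ _ ((norm_fst_le y).trans hy)) (h' _ _ ((norm_snd_le y).trans hy))
          (hΨ0 _) (mul_nonneg hC (hΦ0 _))
    _ = _ := by simp only [Prod.fst_add, Prod.snd_add]; ring

lemma SlowlyVarying.const_mul {V : Type*} [NormedAddCommGroup V] {Φ : V → ℝ}
    (hΦ : SlowlyVarying Φ) {c : ℝ} (hc : 0 ≤ c) : SlowlyVarying fun v => c * Φ v := fun R => by
  obtain ⟨C, hC, h⟩ := hΦ R
  refine ⟨C, hC, fun x y hy => ?_⟩
  calc c * Φ x ≤ c * (C * Φ (x + y)) := mul_le_mul_of_nonneg_left (h x y hy) hc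
    _ = _ := by ring

/-- The exponent of the decay in the directions of `K_{σ'}`. -/
def decayExponent : ℕ := Module.finrank ℝ (CoSpace σ) + 1

/-- The comparison function `(1 + |t|)^{-s} (1 + ‖y‖)^{-N}` on `K_σ × K_{σ'}`. -/
def decayWeight (s : ℝ) (v : Ambient σ) : ℝ :=
  (1 + ‖v.1‖) ^ (-s) * (1 + ‖v.2‖) ^ (-(decayExponent σ : ℝ))

lemma decayWeight_nonneg (s : ℝ) (v : Ambient σ) : 0 ≤ decayWeight σ s v := by
  unfold decayWeight; positivity

lemma slowlyVarying_decayWeight {s : ℝ} (hs : 0 ≤ s) : SlowlyVarying (decayWeight σ s) :=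
  SlowlyVarying.prod (slowlyVarying_one_add_norm_rpow hs)
    (slowlyVarying_one_add_norm_rpow (Nat.cast_nonneg _)) (fun _ => by positivity)
    (fun _ => by positivity)

lemma integrable_decayWeight {s : ℝ} (hs : 1 < s) : Integrable (decayWeight σ s) :=
  (integrable_one_add_norm (E := ℝ) (by simpa using hs)).mul_prod
    (integrable_one_add_norm (E := CoSpace σ) (by simp [decayExponent]))

/-- The weight is a product, so the exponent at `σ` only has to beat dimension one; a power of the
full norm would have to beat the degree of `K`. -/
lemma summable_decayWeight {s : ℝ} (hs : 1 < s) :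
    Summable fun n : ι → ℤ => decayWeight σ s (toAmbient σ (latticePoint b n)) := by
  simp only [toAmbient_latticePoint, ← ambientBasis_apply]
  exact summable_basis_of_slowlyVarying volume (ambientBasis σ b) (integrable_decayWeight σ hs)
    (decayWeight_nonneg σ s) (slowlyVarying_decayWeight σ (by linarith))

variable {σ} {h : CoSpace σ → ℂ}

lemma RapidDecay.le_decay (hh : RapidDecay h) (M : ℕ) : ∃ C : ℝ, 0 ≤ C ∧ ∀ y,
    (1 + ‖y‖) ^ M * ‖h y‖ ≤ C * (1 + ‖y‖) ^ (-(decayExponent σ : ℝ)) := by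
  obtain ⟨C, hC, hb⟩ := hh (M + decayExponent σ)
  refine ⟨C, hC, fun y => ?_⟩
  rw [Real.rpow_neg (by positivity), Real.rpow_natCast, ← div_eq_mul_inv,
    le_div_iff₀ (by positivity)]
  calc _ = (1 + ‖y‖) ^ (M + decayExponent σ) * ‖h y‖ := by rw [pow_add]; ring
    _ ≤ C := hb y

/-- By the norm bound, replacing `|σ(α)|^{-s}` by `(1 + |σ(α)|)^{-s}` costs at most a power of `1 +
‖α'‖`, which the rapid decay of `h` absorbs. -/
lemma summable_norm_div_rpow (hh : RapidDecay h) {s : ℝ} (hs : 1 < s) :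
    Summable fun n : ι → ℤ =>
      ‖h (conj σ (latticePoint b n))‖ / |emb σ (latticePoint b n)| ^ s := by
  obtain ⟨c, hc, hlow⟩ := exists_le_abs_emb_mul σ b
  set d := Module.finrank ℚ K
  -- `d * s` is the power of `1 + ‖α'‖` to be absorbed, rounded up to an integer.
  obtain ⟨M, hM⟩ := exists_nat_ge (d * s)
  obtain ⟨C, hC, hb⟩ := hh.le_decay M
  refine Summable.of_nonneg_of_le (fun n => by positivity) (fun n => ?_)
    ((summable_decayWeight σ b hs).mul_left ((c⁻¹ + 1) ^ s * C))
  set α := latticePoint b n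
  by_cases hn : n = 0
  · have : α = 0 := by simp [α, hn, latticePoint_zero]
    -- The term at the origin is `0`, by division by zero.
    rw [this, map_zero, abs_zero, Real.zero_rpow (by linarith), div_zero]
    have := decayWeight_nonneg σ s (toAmbient σ 0)
    positivity
  have hl := hlow n hn
  set t := |emb σ α|
  set B := 1 + ‖conj σ α‖
  have hB : 1 ≤ B := le_add_of_nonneg_right (norm_nonneg _)
  have hBd : 1 ≤ B ^ d := one_le_pow₀ hB
  have ht : 0 < t := by
    by_contra hneg
    have : t = 0 := le_antisymm (not_lt.1 hneg) (abs_nonneg _)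
    rw [this, zero_mul] at hl
    linarith
  have h1 : 1 + t ≤ t * ((c⁻¹ + 1) * B ^ d) := by
    have h2 : 1 ≤ c⁻¹ * (t * B ^ d) := by
      rw [inv_mul_eq_div, le_div_iff₀ hc, one_mul]; exact hl
    nlinarith
  have h2 : (1 + t) ^ s ≤ t ^ s * ((c⁻¹ + 1) ^ s * B ^ M) := by
    calc (1 + t) ^ s ≤ (t * ((c⁻¹ + 1) * B ^ d)) ^ s :=
          Real.rpow_le_rpow (by positivity) h1 (by linarith)
      _ = t ^ s * ((c⁻¹ + 1) ^ s * B ^ (d * s)) := by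
          rw [Real.mul_rpow (by positivity) (by positivity),
            Real.mul_rpow (by positivity) (by positivity), ← Real.rpow_natCast_mul (by positivity)]
      _ ≤ _ := by
          rw [← Real.rpow_natCast B M]
          gcongr
  have h3 : 1 / t ^ s ≤ (c⁻¹ + 1) ^ s * B ^ M * (1 + t) ^ (-s) := by
    rw [Real.rpow_neg (by positivity), ← div_eq_mul_inv,
      div_le_div_iff₀ (by positivity) (by positivity), one_mul]
    linarith
  calc ‖h (conj σ α)‖ / t ^ s = ‖h (conj σ α)‖ * (1 / t ^ s) := by ring
    _ ≤ ‖h (conj σ α)‖ * ((c⁻¹ + 1) ^ s * B ^ M * (1 + t) ^ (-s)) := by gcongr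
    _ = (c⁻¹ + 1) ^ s * (1 + t) ^ (-s) * (B ^ M * ‖h (conj σ α)‖) := by ring
    _ ≤ (c⁻¹ + 1) ^ s * (1 + t) ^ (-s) * (C * B ^ (-(decayExponent σ : ℝ))) := by
      exact mul_le_mul_of_nonneg_left (hb _) (by positivity)
    _ = _ := by
      simp only [decayWeight, toAmbient_fst, toAmbient_snd, Real.norm_eq_abs]
      ring

lemma exp_neg_mul_sq_le {a : ℝ} (ha : 0 < a) (t : ℝ) :
    Real.exp (-a * t ^ 2) ≤ 2 / min 1 a * (1 + ‖t‖) ^ (-(2 : ℝ)) := by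
  have hm : 0 < min 1 a := by positivity
  rw [Real.rpow_neg (by positivity), Real.rpow_two, neg_mul, Real.exp_neg, ← div_eq_mul_inv,
    div_div, inv_eq_one_div, div_le_div_iff₀ (Real.exp_pos _) (by positivity), one_mul]
  have h1 := Real.add_one_le_exp (a * t ^ 2)
  have h2 : (1 + ‖t‖) ^ 2 ≤ 2 * (1 + t ^ 2) := by
    rw [Real.norm_eq_abs]
    nlinarith [sq_abs t, sq_nonneg (|t| - 1)]
  have h3 : min 1 a * (1 + t ^ 2) ≤ a * t ^ 2 + 1 := by
    nlinarith [min_le_left 1 a, min_le_right 1 a, sq_nonneg t]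
  nlinarith

lemma exists_gaussian_le (hh : RapidDecay h) {a : ℝ} (ha : 0 < a) : ∃ C : ℝ, 0 ≤ C ∧
    ∀ v : Ambient σ, Real.exp (-a * v.1 ^ 2) * ‖h v.2‖ ≤ C * decayWeight σ 2 v := by
  obtain ⟨C, hC, hb⟩ := hh.le_decay 0
  refine ⟨2 / min 1 a * C, by positivity, fun v => ?_⟩
  calc _ ≤ (2 / min 1 a * (1 + ‖v.1‖) ^ (-(2 : ℝ))) *
        (C * (1 + ‖v.2‖) ^ (-(decayExponent σ : ℝ))) := by
        gcongr
        · exact exp_neg_mul_sq_le ha _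
        · simpa using hb v.2
    _ = _ := by unfold decayWeight; ring

lemma summable_gaussian (hh : RapidDecay h) {a : ℝ} (ha : 0 < a) : Summable fun n : ι → ℤ =>
    Real.exp (-a * emb σ (latticePoint b n) ^ 2) * ‖h (conj σ (latticePoint b n))‖ := by
  obtain ⟨C, hC, hb⟩ := exists_gaussian_le hh ha
  exact Summable.of_nonneg_of_le (fun n => by positivity) (fun n => hb (toAmbient σ _))
    ((summable_decayWeight σ b one_lt_two).mul_left C)

end Summability

end Quasicrystal

/-! ### Fourier transform for the trace form, theta series and covolume -/

namespace Quasicrystal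

noncomputable section FourierSide

open MeasureTheory

variable {K : Type*} [Field K] [NumberField K] {σ : RealPlace K}

lemma rapidDecay_schwartz (f : SchwartzMap (CoSpace σ) ℂ) : RapidDecay f := fun N => by
  refine ⟨_, ?_, fun y => by
    simpa using SchwartzMap.one_add_le_sup_seminorm_apply (𝕜 := ℝ) (m := (N, 0)) (k := N) (n := 0)
      le_rfl le_rfl f y⟩
  positivity

/-- Complex conjugation at the complex places. -/
def starComplex (w : CoSpace σ) : CoSpace σ := (w.1, fun v => star (w.2 v))

lemma norm_starComplex (w : CoSpace σ) : ‖starComplex w‖ = ‖w‖ := by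
  simp [starComplex, Prod.norm_def, Pi.norm_def]

/-- The trace form is indefinite at complex places; conjugating one argument there makes it positive
definite. -/
lemma sq_norm_le_tracePairing_starComplex (w : CoSpace σ) :
    ‖w‖ ^ 2 ≤ tracePairing σ (starComplex w) w := by
  have h1 : ∀ v, 0 ≤ w.1 v * w.1 v := fun v => mul_self_nonneg _
  have h2 : ∀ v, 2 * (star (w.2 v) * w.2 v).re = 2 * ‖w.2 v‖ ^ 2 := fun v => by
    rw [← Complex.normSq_eq_norm_sq, Complex.normSq_apply]; simp
  have h3 : ∀ v, 0 ≤ 2 * ‖w.2 v‖ ^ 2 := fun v => by positivity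
  have hT : tracePairing σ (starComplex w) w =
      ∑ v, w.1 v * w.1 v + ∑ v, 2 * ‖w.2 v‖ ^ 2 := by
    simp only [tracePairing, starComplex, h2]
  have hT0 : 0 ≤ tracePairing σ (starComplex w) w := by
    rw [hT]
    exact add_nonneg (Finset.sum_nonneg fun v _ => h1 v) (Finset.sum_nonneg fun v _ => h3 v)
  rw [← Real.le_sqrt (norm_nonneg _) hT0]
  refine max_le ?_ ?_
  · refine (pi_norm_le_iff_of_nonneg (Real.sqrt_nonneg _)).2 fun v => ?_
    rw [Real.le_sqrt (norm_nonneg _) hT0, hT, Real.norm_eq_abs, sq_abs, sq]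
    exact (Finset.single_le_sum (fun v _ => h1 v) (Finset.mem_univ v)).trans
      (le_add_of_nonneg_right (Finset.sum_nonneg fun v _ => h3 v))
  · refine (pi_norm_le_iff_of_nonneg (Real.sqrt_nonneg _)).2 fun v => ?_
    rw [Real.le_sqrt (norm_nonneg _) hT0, hT]
    have := Finset.single_le_sum (fun v _ => h3 v) (Finset.mem_univ v)
    have h4 := Finset.sum_nonneg fun v (_ : v ∈ Finset.univ) => h1 v
    nlinarith [sq_nonneg ‖w.2 v‖]

/-- The Fourier transform for the trace form, without the normalising factor. -/
def traceFourier (f : CoSpace σ → ℂ) (η : CoSpace σ) : ℂ :=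
  ∫ y, Complex.exp (-(2 * (Real.pi : ℂ) * Complex.I * (tracePairing σ y η : ℂ))) * f y

lemma traceFourier_eq_fourierIntegral (f : CoSpace σ → ℂ) (η : CoSpace σ) : traceFourier f η =
    VectorFourier.fourierIntegral Real.fourierChar volume (traceBilin σ).toLinearMap₁₂ f η := by
  unfold traceFourier VectorFourier.fourierIntegral
  refine integral_congr_ae (.of_forall fun y => ?_)
  simp only [Circle.smul_def, Real.fourierChar_apply, smul_eq_mul]
  congr 2
  change _ = ((2 * Real.pi * -(tracePairing σ y η) : ℝ) : ℂ) * Complex.I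
  push_cast
  ring

/-- Differentiating `f` `n` times in the direction `starComplex w` multiplies its transform at `w`
by a factor of size at least `‖w‖ ^ (2 * n)`, while the direction itself costs only `‖w‖ ^ n`. -/
lemma rapidDecay_traceFourier (f : SchwartzMap (CoSpace σ) ℂ) : RapidDecay (traceFourier f) := by
  have key : ∀ n : ℕ, ∃ C : ℝ, 0 ≤ C ∧ ∀ w, ‖w‖ ^ n * ‖traceFourier f w‖ ≤ C := fun n => by
    have h := fun w => VectorFourier.pow_mul_norm_iteratedFDeriv_fourierIntegral_le (traceBilin σ)
      (μ := volume) (f := f) (K := ⊤) (N := ⊤) (f.smooth ⊤)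
      (fun k n _ _ => f.integrable_pow_mul_iteratedFDeriv volume k n) (k := 0) (n := n) le_top le_top
      (starComplex w) w
    simp only [norm_iteratedFDeriv_zero, pow_zero, mul_one, norm_starComplex, traceBilin_apply,
      ← traceFourier_eq_fourierIntegral, mul_assoc] at h
    set S := ((2 * ((0 : ℕ) : ℝ) + 2) ^ n * _ : ℝ) with hS
    have hS0 : 0 ≤ S := by positivity
    refine ⟨S, hS0, fun w => ?_⟩
    have hw := h w
    rcases eq_or_ne (‖w‖ ^ n) 0 with h0 | h0
    · rw [h0, zero_mul]; exact hS0
    have hpos : 0 < ‖w‖ ^ n := lt_of_le_of_ne (by positivity) (Ne.symm h0)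
    refine le_of_mul_le_mul_left (le_trans ?_ hw) hpos
    rw [← mul_assoc]
    refine mul_le_mul_of_nonneg_right ?_ (norm_nonneg _)
    rw [← mul_pow, ← sq]
    exact pow_le_pow_left₀ (by positivity)
      ((sq_norm_le_tracePairing_starComplex w).trans (le_abs_self _)) _
  intro N
  obtain ⟨C, hC, h⟩ := key N
  obtain ⟨C', hC', h'⟩ := key 0
  -- From `(1 + t)^N ≤ 2^(N-1) (1 + t^N)`, so the exponents `0` and `N` suffice.
  refine ⟨2 ^ (N - 1) * (C' + C), by positivity, fun y => ?_⟩
  calc (1 + ‖y‖) ^ N * ‖traceFourier f y‖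
      ≤ 2 ^ (N - 1) * (1 ^ N + ‖y‖ ^ N) * ‖traceFourier f y‖ := by
        gcongr
        exact add_pow_le zero_le_one (norm_nonneg _) N
    _ = 2 ^ (N - 1) * (‖y‖ ^ 0 * ‖traceFourier f y‖ + ‖y‖ ^ N * ‖traceFourier f y‖) := by
        rw [one_pow, pow_zero]; ring
    _ ≤ _ := by gcongr <;> [exact h' y; exact h y]

lemma fourierDual_eq (f : CoSpace σ → ℂ) (η : CoSpace σ) : fourierDual σ f η =
    (1 / (2 * (Real.pi : ℂ))) * 2 ^ (InfinitePlace.nrComplexPlaces K) * traceFourier f η := rfl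

lemma rapidDecay_fourierDual (f : SchwartzMap (CoSpace σ) ℂ) : RapidDecay (fourierDual σ f) :=
  fun N => by
    obtain ⟨C, hC, h⟩ := rapidDecay_traceFourier f N
    refine ⟨‖(1 / (2 * (Real.pi : ℂ))) * 2 ^ (InfinitePlace.nrComplexPlaces K)‖ * C,
      by positivity, fun y => ?_⟩
    rw [fourierDual_eq, norm_mul, mul_left_comm]
    exact mul_le_mul_of_nonneg_left (h y) (norm_nonneg _)

lemma tracePairing_neg_left (y z : CoSpace σ) : tracePairing σ (-y) z = -tracePairing σ y z := by
  rw [← neg_one_smul ℝ y, tracePairing_smul_left, neg_one_mul]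

lemma tracePairing_neg_right (y z : CoSpace σ) : tracePairing σ y (-z) = -tracePairing σ y z := by
  rw [tracePairing_comm, tracePairing_neg_left, tracePairing_comm]

lemma fourierDual_neg {f : CoSpace σ → ℂ} (hf : ∀ y, f (-y) = f y) (η : CoSpace σ) :
    fourierDual σ f (-η) = fourierDual σ f η := by
  have h : traceFourier f (-η) = traceFourier f η := by
    have h := Measure.integral_comp_smul volume (fun y => Complex.exp (-(2 * (Real.pi : ℂ) *
      Complex.I * (tracePairing σ y η : ℂ))) * f y) (-1)
    simp only [neg_one_smul, hf, tracePairing_neg_left, abs_inv, abs_pow, abs_neg, abs_one, one_pow,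
      inv_one, one_smul] at h
    simp only [traceFourier, tracePairing_neg_right, h]
  rw [fourierDual_eq, fourierDual_eq, h]

lemma integral_gaussian_mul_exp {τ : ℝ} (hτ : 0 < τ) (t' : ℝ) :
    ∫ t : ℝ, Complex.exp (-(2 * Real.pi * Complex.I * (t * t' : ℝ))) *
      (Real.exp (-(Real.pi * τ) * t ^ 2) : ℂ) =
    ((τ ^ (-(1 / 2) : ℝ) : ℝ) : ℂ) * (Real.exp (-(Real.pi * (1 / τ)) * t' ^ 2) : ℂ) := by
  have h := congrFun (fourier_gaussian_pi (b := (τ : ℂ)) (by simpa using hτ)) t'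
  rw [Real.fourier_real_eq_integral_exp_smul] at h
  convert! h using 1
  · refine integral_congr_ae (.of_forall fun t => ?_)
    simp only [smul_eq_mul]
    congr 1
    · congr 1; push_cast; ring
    · push_cast; ring_nf
  · rw [Complex.ofReal_cpow hτ.le, one_div ((τ : ℂ) ^ (1 / 2 : ℂ)), ← Complex.cpow_neg]
    congr 1
    · push_cast; rfl
    · push_cast; congr 1; ring

lemma integral_ambient_gaussian {τ : ℝ} (hτ : 0 < τ) (f : CoSpace σ → ℂ) (w : Ambient σ) :
    ∫ v : Ambient σ, Complex.exp (-(2 * Real.pi * Complex.I * (ambientPairing σ v w : ℝ))) *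
      ((Real.exp (-(Real.pi * τ) * v.1 ^ 2) : ℂ) * f v.2) =
    ((τ ^ (-(1 / 2) : ℝ) : ℝ) : ℂ) * ((Real.exp (-(Real.pi * (1 / τ)) * w.1 ^ 2) : ℂ) *
      traceFourier f w.2) := by
  rw [← mul_assoc, ← integral_gaussian_mul_exp hτ, traceFourier, ← integral_prod_mul]
  refine integral_congr_ae (.of_forall fun v => ?_)
  simp only [ambientPairing]
  rw [Complex.ofReal_add, mul_add, neg_add, Complex.exp_add]
  ring

variable {ι : Type*} [Fintype ι] (b : Module.Basis ι ℚ K)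

/-- The theta series of a lattice in `K`, weighted by a function on `K_{σ'}`. -/
def theta (h : CoSpace σ → ℂ) (τ : ℝ) : ℂ := ∑' n : ι → ℤ,
  (Real.exp (-(Real.pi * τ) * emb σ (latticePoint b n) ^ 2) : ℂ) * h (conj σ (latticePoint b n))

lemma summable_theta {h : CoSpace σ → ℂ} (hh : RapidDecay h) {τ : ℝ} (hτ : 0 < τ) :
    Summable fun n : ι → ℤ => (Real.exp (-(Real.pi * τ) * emb σ (latticePoint b n) ^ 2) : ℂ) *
      h (conj σ (latticePoint b n)) := by
  refine Summable.of_norm ?_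
  simpa only [norm_mul, Complex.norm_real, Real.norm_eq_abs, Real.abs_exp] using
    summable_gaussian b hh (mul_pos Real.pi_pos hτ)

/-- Poisson summation for the Gaussian in `σ` times `f`; the Gaussian transform gives `τ^{-1/2}` and
inverts `τ`. -/
lemma theta_functional_equation (f : SchwartzMap (CoSpace σ) ℂ) {τ : ℝ} (hτ : 0 < τ) :
    theta b f τ = ((volume.real (ZSpan.fundamentalDomain (ambientBasis σ b)) : ℂ)⁻¹ *
      ((τ ^ (-(1 / 2) : ℝ) : ℝ) : ℂ)) * theta b.traceDual (traceFourier f) (1 / τ) := by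
  obtain ⟨C, hC, hb⟩ := exists_gaussian_le (rapidDecay_schwartz f) (mul_pos Real.pi_pos hτ)
  let g : Ambient σ → ℂ := fun v => (Real.exp (-(Real.pi * τ) * v.1 ^ 2) : ℂ) * f v.2
  have hg : Continuous g := by
    have := f.continuous
    fun_prop
  have hI : ∀ m : ι → ℤ, ∫ v, Complex.exp (-(2 * Real.pi * Complex.I *
      (∑ i, (m i : ℝ) * (ambientBasis σ b).repr v i : ℝ))) * g v =
      ((τ ^ (-(1 / 2) : ℝ) : ℝ) : ℂ) *
      ((Real.exp (-(Real.pi * (1 / τ)) * emb σ (latticePoint b.traceDual m) ^ 2) : ℂ) *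
      traceFourier f (conj σ (latticePoint b.traceDual m))) := fun m => by
    simp only [sum_mul_ambientBasis_repr, g]
    exact integral_ambient_gaussian hτ f _
  have hP := poisson_summation_basis volume (ambientBasis σ b) hg
    ((integrable_decayWeight σ one_lt_two).const_mul C)
    ((slowlyVarying_decayWeight σ zero_le_two).const_mul hC)
    (fun v => by
      simpa only [g, norm_mul, Complex.norm_real, Real.norm_eq_abs, Real.abs_exp] using hb v)
    (by
      simp only [hI]
      exact (summable_theta b.traceDual (rapidDecay_traceFourier f) (one_div_pos.2 hτ)).mul_left _)
  simp only [hI, ambientBasis_apply, ← toAmbient_latticePoint, tsum_mul_left] at hP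
  rw [mul_assoc]
  exact hP

lemma fundamentalDomain_ambientBasis (A : (FractionalIdeal (𝓞 K)⁰ K)ˣ) :
    volume (ZSpan.fundamentalDomain (ambientBasis σ (basisOfFractionalIdeal K A))) =
      volume (ZSpan.fundamentalDomain (mixedEmbedding.fractionalIdealLatticeBasis K A)) := by
  have h : ambientBasis σ (basisOfFractionalIdeal K A) =
      (mixedEmbedding.fractionalIdealLatticeBasis K A).map (mixedEquiv σ) := by
    ext1 i
    simp [mixedEquiv_mixedEmbedding]
  rw [h, ← ZSpan.map_fundamentalDomain, ← (measurePreserving_mixedEquiv σ).measure_preimage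
    ((ZSpan.map_fundamentalDomain _ (mixedEquiv σ)).symm ▸
      (ZSpan.fundamentalDomain_measurableSet _)).nullMeasurableSet,
    Set.preimage_image_eq _ (mixedEquiv σ).injective]

/-- The transition matrix from an integral basis to a basis of the ideal has determinant of absolute
value `absNorm`, and the discriminant scales by its square. -/
lemma disc_eq (A : (FractionalIdeal (𝓞 K)⁰ K)ˣ) :
    disc A = (FractionalIdeal.absNorm (A : FractionalIdeal (𝓞 K)⁰ K)) ^ 2 * discr K := by
  let e : (Module.Free.ChooseBasisIndex ℤ (𝓞 K)) ≃ (Module.Free.ChooseBasisIndex ℤ A) := by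
    refine Fintype.equivOfCardEq ?_
    rw [← Module.finrank_eq_card_chooseBasisIndex, ← Module.finrank_eq_card_chooseBasisIndex,
      fractionalIdeal_rank]
  have h := det_basisOfFractionalIdeal_eq_absNorm K A e
  rw [← h, sq_abs, coe_discr, Module.Basis.det_apply, ← Algebra.discr_of_matrix_vecMul,
    Module.Basis.toMatrix_map_vecMul, disc, Module.Basis.coe_reindex, Equiv.symm_symm]
  exact (Algebra.discr_reindex ℚ (basisOfFractionalIdeal K A) e.symm).symm

lemma volume_fundamentalDomain_eq (A : (FractionalIdeal (𝓞 K)⁰ K)ˣ) :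
    volume.real (ZSpan.fundamentalDomain (ambientBasis σ (basisOfFractionalIdeal K A))) =
      (2 ^ (InfinitePlace.nrComplexPlaces K))⁻¹ * Real.sqrt |((disc A : ℚ) : ℝ)| := by
  rw [measureReal_def, fundamentalDomain_ambientBasis,
    mixedEmbedding.volume_fundamentalDomain_fractionalIdealLatticeBasis,
    mixedEmbedding.volume_fundamentalDomain_latticeBasis, disc_eq]
  have h0 : (0 : ℝ) ≤ (FractionalIdeal.absNorm (A : FractionalIdeal (𝓞 K)⁰ K) : ℚ) := by
    exact_mod_cast FractionalIdeal.absNorm_nonneg _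
  push_cast
  rw [abs_mul, abs_of_nonneg (sq_nonneg _), Real.sqrt_mul (sq_nonneg _), Real.sqrt_sq h0]
  rw [ENNReal.toReal_mul, ENNReal.toReal_ofReal h0]
  simp [Int.norm_eq_abs]
  ring

end FourierSide

end Quasicrystal

/-! ### Decay of theta series and the Mellin pair of weight `1 / 2` -/

namespace Quasicrystal

noncomputable section FunctionalEquation

open MeasureTheory Set Filter

lemma hasSimplePole_of_eventuallyEq {F H : ℂ → ℂ} {a ρ : ℂ} (hH : AnalyticAt ℂ H a)
    (hF : ∀ᶠ s in 𝓝[≠] a, F s = ρ / (s - a) + H s) : HasSimplePole F a ρ := by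
  have hid : AnalyticAt ℂ (fun s : ℂ => s - a) a := analyticAt_id.sub analyticAt_const
  have hmer : MeromorphicAt (fun s => ρ / (s - a) + H s) a :=
    ((MeromorphicAt.const ρ a).div hid.meromorphicAt).add hH.meromorphicAt
  have hne : ∀ᶠ s in 𝓝[≠] a, s ≠ a := eventually_mem_nhdsWithin
  have hFm : MeromorphicAt F a := hmer.congr (hF.mono fun _ h => h.symm)
  have hord : meromorphicOrderAt F a = meromorphicOrderAt (fun s => ρ / (s - a) + H s) a :=
    meromorphicOrderAt_congr hF
  have hcase : (ρ ≠ 0 → meromorphicOrderAt F a = -1) ∧ (ρ = 0 → 0 ≤ meromorphicOrderAt F a) := by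
    constructor
    · intro hρ
      refine (meromorphicOrderAt_eq_int_iff (n := -1) hFm).2
        ⟨fun s => ρ + (s - a) * H s, analyticAt_const.add (hid.mul hH), by simpa using hρ, ?_⟩
      filter_upwards [hF, hne] with s hs hsa
      have : s - a ≠ 0 := sub_ne_zero.2 hsa
      rw [hs, zpow_neg_one, smul_eq_mul]
      field_simp
    · rintro rfl
      rw [hord]
      simpa using hH.meromorphicOrderAt_nonneg
  refine ⟨hFm, ?_, ⟨fun h hρ => ?_, hcase.1⟩, ?_⟩
  · by_cases hρ : ρ = 0
    · exact le_trans (by decide) (hcase.2 hρ)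
    · exact (hcase.1 hρ).ge
  · have h0 := hcase.2 hρ
    rw [h] at h0
    exact absurd h0 (by decide)
  · have h1 : Tendsto (fun s => ρ + (s - a) * H s) (𝓝[≠] a) (𝓝 ρ) := by
      have this : AnalyticAt ℂ (fun s => ρ + (s - a) * H s) a :=
        analyticAt_const.add (hid.mul hH)
      simpa using this.continuousAt.tendsto.mono_left nhdsWithin_le_nhds
    refine h1.congr' ?_
    filter_upwards [hF, hne] with s hs hsa
    have : s - a ≠ 0 := sub_ne_zero.2 hsa
    rw [hs]
    field_simp

/-- The completed function attached to a pair of theta series of weight `1 / 2`. -/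
def halfLambda (P : WeakFEPair ℂ) (s : ℂ) : ℂ := P.Λ (s / 2) / 2

section HalfLambda

variable {P : WeakFEPair ℂ}

/-- `P.Λ₀` is entire, so the poles sit in two explicit terms; dividing by `2` undoes the rescaling
of their residues by `s ↦ s / 2`. -/
lemma halfLambda_eq (hk : P.k = 1 / 2) (s : ℂ) : halfLambda P s =
    P.Λ₀ (s / 2) / 2 - P.f₀ / s - P.ε * P.g₀ / (1 - s) := by
  have h := P.Λ₀_eq (s / 2)
  have h1 : ((P.k : ℝ) : ℂ) - s / 2 = (1 - s) / 2 := by rw [hk]; push_cast; ring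
  rw [halfLambda, h, h1]
  simp only [smul_eq_mul, div_div_eq_mul_div]
  ring

lemma analyticAt_halfLambda₀ (P : WeakFEPair ℂ) (s : ℂ) : AnalyticAt ℂ (fun s => P.Λ₀ (s / 2) / 2) s :=
  ((P.differentiable_Λ₀.comp (differentiable_id.div_const 2)).div_const 2).analyticAt s

lemma meromorphicAt_halfLambda (hk : P.k = 1 / 2) (s : ℂ) : MeromorphicAt (halfLambda P) s := by
  rw [funext (halfLambda_eq hk)]
  exact ((analyticAt_halfLambda₀ P s).meromorphicAt.sub
    ((MeromorphicAt.const _ s).div (MeromorphicAt.id s))).sub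
    ((MeromorphicAt.const _ s).div ((MeromorphicAt.const _ s).sub (MeromorphicAt.id s)))

lemma analyticAt_halfLambda (hk : P.k = 1 / 2) {s : ℂ} (h0 : s ≠ 0) (h1 : s ≠ 1) : AnalyticAt ℂ (halfLambda P) s := by
  rw [funext (halfLambda_eq hk)]
  exact ((analyticAt_halfLambda₀ P s).sub (analyticAt_const.div analyticAt_id h0)).sub
    (analyticAt_const.div (analyticAt_const.sub analyticAt_id) (sub_ne_zero.2 h1.symm))

lemma hasSimplePole_halfLambda_zero (hk : P.k = 1 / 2) : HasSimplePole (halfLambda P) 0 (-P.f₀) := by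
  refine hasSimplePole_of_eventuallyEq (H := fun s => P.Λ₀ (s / 2) / 2 - P.ε * P.g₀ / (1 - s))
    ((analyticAt_halfLambda₀ P 0).sub
      (analyticAt_const.div (analyticAt_const.sub analyticAt_id) (by simp))) (.of_forall fun s => ?_)
  rw [halfLambda_eq hk, sub_zero]
  ring

lemma hasSimplePole_halfLambda_one (hk : P.k = 1 / 2) : HasSimplePole (halfLambda P) 1 (P.ε * P.g₀) := by
  refine hasSimplePole_of_eventuallyEq (H := fun s => P.Λ₀ (s / 2) / 2 - P.f₀ / s)
    ((analyticAt_halfLambda₀ P 1).sub (analyticAt_const.div analyticAt_id one_ne_zero))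
    (.of_forall fun s => ?_)
  rw [halfLambda_eq hk, ← neg_sub s 1, div_neg]
  ring

lemma halfLambda_one_sub (hk : P.k = 1 / 2) (s : ℂ) : halfLambda P s = P.ε * halfLambda P.symm (1 - s) := by
  have h := P.functional_equation ((1 - s) / 2)
  have h1 : ((P.k : ℝ) : ℂ) - (1 - s) / 2 = s / 2 := by rw [hk]; push_cast; ring
  rw [h1, smul_eq_mul] at h
  rw [halfLambda, halfLambda, h, mul_div_assoc]

end HalfLambda

variable {K : Type*} [Field K] [NumberField K] {σ : RealPlace K}
  {ι : Type*} [Fintype ι] (b : Module.Basis ι ℚ K) {h : CoSpace σ → ℂ}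

lemma emb_latticePoint_eq_zero {n : ι → ℤ} : emb σ (latticePoint b n) = 0 ↔ n = 0 := by
  rw [map_eq_zero, ← latticePoint_zero b, (latticePoint_injective b).eq_iff]

lemma continuousOn_theta (hh : RapidDecay h) : ContinuousOn (theta b h) (Ioi 0) := by
  have key : ∀ a : ℝ, 0 < a → ContinuousOn (theta b h) (Ici a) := fun a ha => by
    refine continuousOn_tsum (fun n => by fun_prop)
      (summable_gaussian b hh (mul_pos Real.pi_pos ha)) fun n τ hτ => ?_
    rw [norm_mul, Complex.norm_real, Real.norm_eq_abs, Real.abs_exp]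
    have hτ' : a ≤ τ := hτ
    gcongr
  intro τ hτ
  have hτ' : (0 : ℝ) < τ := hτ
  exact ((key (τ / 2) (by positivity)).continuousAt
    (Ici_mem_nhds (by linarith))).continuousWithinAt

lemma hasSum_theta_sub (hh : RapidDecay h) {τ : ℝ} (hτ : 0 < τ) :
    HasSum (fun n : ι → ℤ => if emb σ (latticePoint b n) = 0 then 0 else
      h (conj σ (latticePoint b n)) * (Real.exp (-Real.pi * emb σ (latticePoint b n) ^ 2 * τ) : ℂ))
      (theta b h τ - h 0) := by
  refine ((summable_theta b hh hτ).hasSum.sub (hasSum_ite_eq (0 : ι → ℤ) (h 0))).congr_fun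
    fun n => ?_
  simp only [emb_latticePoint_eq_zero]
  split_ifs with hn
  · have h0 : conj σ (0 : K) = 0 := congrArg Prod.snd (map_zero (toAmbient σ))
    simp [hn, latticePoint_zero, h0]
  · rw [sub_zero, mul_comm]
    congr 3
    ring

/-- The values `σ(α)` may come arbitrarily close to `0`, so no uniform exponential decay is
available. Instead `exp(-x) ≤ k! / x^k` is summed against the convergent series with exponent `2k`.
-/
lemma theta_sub_isBigO (hh : RapidDecay h) (r : ℝ) :
    (fun τ => theta b h τ - h 0) =O[atTop] fun τ : ℝ => τ ^ r := by
  -- `k ≥ 1` puts `2k` in the range of convergence, and `k ≥ -r` gives `τ^{-k} ≤ τ^r` for `τ ≥ 1`.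
  obtain ⟨k, hk⟩ := exists_nat_ge (max 1 (-r))
  have hk1 : (1 : ℝ) ≤ k := (le_max_left _ _).trans hk
  have hkr : -r ≤ k := (le_max_right _ _).trans hk
  have hS := summable_norm_div_rpow b hh (s := ((2 * k : ℕ) : ℝ)) (by push_cast; linarith)
  refine Asymptotics.IsBigO.of_bound ((k.factorial : ℝ) * ∑' n : ι → ℤ,
    ‖h (conj σ (latticePoint b n))‖ / |emb σ (latticePoint b n)| ^ ((2 * k : ℕ) : ℝ)) ?_
  filter_upwards [eventually_ge_atTop 1] with τ hτ
  have hτ0 : 0 < τ := by linarith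
  have hle : ∀ n : ι → ℤ, ‖if emb σ (latticePoint b n) = 0 then (0 : ℂ) else
      h (conj σ (latticePoint b n)) * (Real.exp (-Real.pi * emb σ (latticePoint b n) ^ 2 * τ) : ℂ)‖
      ≤ ((k.factorial : ℝ) * τ ^ r) * (‖h (conj σ (latticePoint b n))‖ /
        |emb σ (latticePoint b n)| ^ ((2 * k : ℕ) : ℝ)) := fun n => by
    split_ifs with hn
    · rw [norm_zero]; positivity
    set t := emb σ (latticePoint b n)
    have ht : 0 < |t| := abs_pos.2 hn
    rw [norm_mul, Complex.norm_real, Real.norm_eq_abs, Real.abs_exp, Real.rpow_natCast, pow_mul,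
      sq_abs]
    have h1 : (t ^ 2 * τ) ^ k / k.factorial ≤ Real.exp (Real.pi * t ^ 2 * τ) :=
      (Real.pow_div_factorial_le_exp _ (by positivity) k).trans (Real.exp_le_exp.2 (by
        rw [mul_assoc]
        exact le_mul_of_one_le_left (by positivity) (by linarith [Real.pi_gt_three])))
    have ht2 : 0 < t ^ 2 := by positivity
    have h2 : Real.exp (-Real.pi * t ^ 2 * τ) ≤ k.factorial * (τ ^ k)⁻¹ / (t ^ 2) ^ k := by
      rw [neg_mul, neg_mul, Real.exp_neg]
      calc _ ≤ ((t ^ 2 * τ) ^ k / k.factorial)⁻¹ := inv_anti₀ (by positivity) h1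
        _ = _ := by rw [inv_div, mul_pow]; field_simp
    have h3 : (τ ^ k)⁻¹ ≤ τ ^ r := by
      rw [← Real.rpow_natCast, ← Real.rpow_neg hτ0.le]
      exact Real.rpow_le_rpow_of_exponent_le hτ (by linarith)
    calc _ ≤ ‖h (conj σ (latticePoint b n))‖ * (k.factorial * τ ^ r / (t ^ 2) ^ k) := by
          gcongr
          exact h2.trans (by gcongr)
      _ = _ := by ring
  have hs := hasSum_theta_sub b hh hτ0
  rw [← hs.tsum_eq, Real.norm_of_nonneg (Real.rpow_nonneg hτ0.le r)]
  refine (tsum_of_norm_bounded (hS.hasSum.mul_left _) hle).trans_eq ?_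
  ring

lemma theta_const_mul (c : ℂ) (τ : ℝ) : theta b (fun y => c * h y) τ = c * theta b h τ := by
  simp only [theta, ← tsum_mul_left]
  exact tsum_congr fun n => by ring

lemma disc_ne_zero (A : (FractionalIdeal (𝓞 K)⁰ K)ˣ) : disc A ≠ 0 :=
  Algebra.discr_not_zero_of_basis ℚ (basisOfFractionalIdeal K A)

lemma discConst_ne_zero (A : (FractionalIdeal (𝓞 K)⁰ K)ˣ) : discConst A ≠ 0 := by
  have h : (0 : ℝ) < |((disc A : ℚ) : ℝ)| := abs_pos.2 (by exact_mod_cast disc_ne_zero A)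
  unfold discConst
  positivity

/-- The inverse covolume `2^{r₂} / √|disc 𝔄|` divided by the normalisation `2^{r₂} / 2π` of
`fourierDual` is `discConst A`. -/
lemma theta_one_div (A : (FractionalIdeal (𝓞 K)⁰ K)ˣ) (f : SchwartzMap (CoSpace σ) ℂ) {x : ℝ}
    (hx : 0 < x) : theta (basisOfFractionalIdeal K A) f (1 / x) =
      ((discConst A : ℂ) * ((x ^ (1 / 2 : ℝ) : ℝ) : ℂ)) *
        theta (basisOfFractionalIdeal K A).traceDual (fourierDual σ f) x := by
  have hF : fourierDual σ f = fun y => ((1 / (2 * (Real.pi : ℂ))) *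
      2 ^ (InfinitePlace.nrComplexPlaces K)) * traceFourier f y := funext (fourierDual_eq f)
  rw [hF, theta_const_mul, theta_functional_equation _ f (one_div_pos.2 hx), one_div_one_div,
    volume_fundamentalDomain_eq, discConst, one_div, Real.inv_rpow hx.le, ← Real.rpow_neg hx.le,
    neg_neg]
  have hd : (0 : ℝ) < |((disc A : ℚ) : ℝ)| := abs_pos.2 (by exact_mod_cast disc_ne_zero A)
  have hd' : ((Real.sqrt |((disc A : ℚ) : ℝ)| : ℝ) : ℂ) ≠ 0 := by
    exact_mod_cast (Real.sqrt_pos.2 hd).ne'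
  have hpi : (Real.pi : ℂ) ≠ 0 := by exact_mod_cast Real.pi_ne_zero
  push_cast
  field_simp

/-- The theta series of the ideal and of its dual, as a pair related by `τ ↦ 1 / τ`. -/
def thetaPair (A : (FractionalIdeal (𝓞 K)⁰ K)ˣ) (f : SchwartzMap (CoSpace σ) ℂ) :
    WeakFEPair ℂ where
  f := theta (basisOfFractionalIdeal K A) f
  g := theta (basisOfFractionalIdeal K A).traceDual (fourierDual σ f)
  k := 1 / 2
  ε := discConst A
  f₀ := f 0
  g₀ := fourierDual σ f 0
  hf_int := (continuousOn_theta _ (rapidDecay_schwartz f)).locallyIntegrableOn measurableSet_Ioi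
  hg_int := (continuousOn_theta _ (rapidDecay_fourierDual f)).locallyIntegrableOn measurableSet_Ioi
  hk := by norm_num
  hε := by exact_mod_cast discConst_ne_zero A
  h_feq x hx := theta_one_div A f hx
  hf_top r := theta_sub_isBigO _ (rapidDecay_schwartz f) r
  hg_top r := theta_sub_isBigO _ (rapidDecay_fourierDual f) r

end FunctionalEquation

end Quasicrystal

/-! ### From theta series to the series over model sets and dual shells -/

namespace Quasicrystal

noncomputable section Series

open MeasureTheory Set Filter
open scoped Pointwise

variable {K : Type*} [Field K] [NumberField K] {σ : RealPlace K}

section Lattices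

variable {ι : Type*} [Fintype ι] (b : Module.Basis ι ℚ K)

lemma mem_range_latticePoint {α : K} :
    α ∈ range (latticePoint b) ↔ ∀ i, ∃ k : ℤ, b.repr α i = k := by
  constructor
  · rintro ⟨n, rfl⟩ i
    refine ⟨n i, ?_⟩
    have : latticePoint b n = ∑ j, (n j : ℚ) • b j := by
      simp only [latticePoint, Int.cast_smul_eq_zsmul]
    rw [this, b.repr_sum_self]
  · intro h
    choose n hn using h
    refine ⟨n, ?_⟩
    conv_rhs => rw [← b.sum_repr α]
    simp only [latticePoint, hn, Int.cast_smul_eq_zsmul]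

lemma neg_mem_range_latticePoint {α : K} (h : α ∈ range (latticePoint b)) :
    -α ∈ range (latticePoint b) := by
  obtain ⟨n, rfl⟩ := h
  exact ⟨-n, by simp [latticePoint]⟩

lemma lattice_eq_range (A : (FractionalIdeal (𝓞 K)⁰ K)ˣ) :
    lattice A = range (latticePoint (basisOfFractionalIdeal K A)) := by
  ext α
  have h1 : α ∈ lattice A ↔ α ∈ ((A : FractionalIdeal (𝓞 K)⁰ K) : Set K) := Iff.rfl
  rw [h1, ← mem_span_basisOfFractionalIdeal K, Submodule.mem_span_range_iff_exists_fun]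
  rfl

/-- The coordinates of `ξ` in the trace dual basis are its traces against the basis of the ideal. -/
lemma dualLattice_eq_range (A : (FractionalIdeal (𝓞 K)⁰ K)ˣ) :
    dualLattice A = range (latticePoint (basisOfFractionalIdeal K A).traceDual) := by
  ext ξ
  simp only [mem_range_latticePoint, Module.Basis.traceDual_repr_apply, Algebra.traceForm_apply]
  constructor
  · intro h i
    refine h _ ?_
    rw [lattice_eq_range]
    exact ⟨Pi.single i 1, by simp [latticePoint, Pi.single_apply]⟩
  · intro h α hα
    rw [lattice_eq_range] at hα
    obtain ⟨n, rfl⟩ := hα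
    choose k hk using h
    refine ⟨∑ i, n i * k i, ?_⟩
    simp only [latticePoint, Finset.mul_sum, map_sum, mul_smul_comm, map_zsmul, hk]
    push_cast
    simp

/-- An even function vanishing at `0`, summed over a lattice, is twice its sum over the positive
elements. -/
lemma summable_positives_and_tsum {T : K → ℂ} (hT : ∀ α, T (-α) = T α) (hT0 : T 0 = 0)
    (hs : Summable fun n : ι → ℤ => T (latticePoint b n)) :
    (Summable fun α : positives σ (range (latticePoint b)) => T α) ∧
      ∑' n : ι → ℤ, T (latticePoint b n) =
        2 * ∑' α : positives σ (range (latticePoint b)), T α := by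
  set L := range (latticePoint b)
  have hz := latticePoint_injective b
  have hsL : Summable (L.indicator T) := by
    rw [← hz.summable_iff fun α hα => indicator_of_notMem hα T]
    have he : L.indicator T ∘ latticePoint b = fun n => T (latticePoint b n) :=
      funext fun n => indicator_of_mem (mem_range_self n) T
    rwa [he]
  have htL : ∑' n : ι → ℤ, T (latticePoint b n) = ∑' α, L.indicator T α := by
    rw [← tsum_subtype L T]
    exact ((Equiv.ofInjective _ hz).tsum_eq (fun α : L => T α))
  have hsub : positives σ L ⊆ L := fun α hα => hα.1
  have hsP : Summable ((positives σ L).indicator T) := by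
    have := hsL.indicator (positives σ L)
    rwa [indicator_indicator, inter_eq_left.2 hsub] at this
  -- A nonzero lattice element or its negative, not both, is positive at `σ`; at `0` both sides
  -- vanish by `hT0`.
  have hsplit : ∀ α, L.indicator T α =
      (positives σ L).indicator T α + (positives σ L).indicator T (-α) := fun α => by
    by_cases hα : α ∈ L
    · have hα' : -α ∈ L := neg_mem_range_latticePoint b hα
      rw [indicator_of_mem hα]
      rcases lt_trichotomy (emb σ α) 0 with h | h | h
      · rw [indicator_of_notMem (fun h' => lt_asymm h h'.2), zero_add,
          indicator_of_mem (show -α ∈ positives σ L from ⟨hα', by rw [map_neg]; linarith⟩), hT]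
      · have h0 : α = 0 := (map_eq_zero (emb σ)).1 h
        rw [h0, neg_zero, hT0]
        simp [indicator_apply, hT0]
      · rw [indicator_of_mem (show α ∈ positives σ L from ⟨hα, h⟩),
          indicator_of_notMem (fun h' => by have := h'.2; rw [map_neg] at this; linarith), add_zero]
    · have hα' : -α ∉ L := fun h => hα (by
        have := neg_mem_range_latticePoint b h
        rwa [neg_neg] at this)
      rw [indicator_of_notMem hα, indicator_of_notMem (fun h => hα h.1),
        indicator_of_notMem (fun h => hα' h.1), add_zero]
  have hA : Summable (T ∘ ((↑) : positives σ L → K)) := summable_subtype_iff_indicator.2 hsP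
  refine ⟨hA, ?_⟩
  have hsN : Summable ((positives σ L).indicator T ∘ Equiv.neg K) :=
    (Equiv.neg K).summable_iff.2 hsP
  have hadd := hsP.tsum_add hsN
  simp only [Function.comp_apply, Equiv.neg_apply] at hadd
  rw [htL, tsum_congr hsplit, hadd, tsum_subtype]
  have : ∑' α, (positives σ L).indicator T (-α) = ∑' α, (positives σ L).indicator T α :=
    (Equiv.neg K).tsum_eq ((positives σ L).indicator T)
  rw [this, two_mul]

variable {h : CoSpace σ → ℂ}

/-- Termwise, the Mellin transform at `s / 2` of `exp(-πτ σ(α)²)` is the gamma factor over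
`|σ(α)|^s`; evenness folds the lattice onto its positive half. -/
lemma summable_positives_and_mellin (hh : RapidDecay h) (heven : ∀ y, h (-y) = h y) {s : ℂ}
    (hs : 1 < s.re) :
    (Summable fun α : positives σ (range (latticePoint b)) => lTerm σ (weight σ h) s α) ∧
      mellin (fun τ => theta b h τ - h 0) (s / 2) =
        2 * (gammaFactor s * lSeries σ (range (latticePoint b)) (weight σ h) s) := by
  -- The absolute value makes the term even on all of `K`; on positive elements it is `lTerm`.
  let T : K → ℂ := fun α => h (conj σ α) / ((|emb σ α| : ℝ) : ℂ) ^ s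
  have hs0 : s ≠ 0 := fun h0 => by rw [h0] at hs; norm_num at hs
  have hT : ∀ α, T (-α) = T α := fun α => by
    simp only [T, conj_neg, heven, map_neg, abs_neg]
  have hT0 : T 0 = 0 := by simp [T, Complex.zero_cpow hs0]
  have habs := summable_norm_div_rpow b hh hs
  have hsum : Summable fun n : ι → ℤ => T (latticePoint b n) := by
    refine Summable.of_norm (habs.congr fun n => ?_)
    simp only [T, norm_div]
    congr 1
    rcases eq_or_lt_of_le (abs_nonneg (emb σ (latticePoint b n))) with h0 | h0
    · rw [← h0, Complex.ofReal_zero, Complex.zero_cpow hs0, norm_zero,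
        Real.zero_rpow (by linarith)]
    · rw [Complex.norm_cpow_eq_rpow_re_of_pos h0]
  have hm := hasSum_mellin_pi_mul_sq (s := s) (by linarith)
    (fun t ht => hasSum_theta_sub b hh (τ := t) ht) habs
  obtain ⟨h1, h2⟩ := summable_positives_and_tsum (σ := σ) b hT hT0 hsum
  have hTl : ∀ α : positives σ (range (latticePoint b)), T α = lTerm σ (weight σ h) s α :=
    fun α => by simp only [T, lTerm, weight, abs_of_pos α.2.2]
  refine ⟨h1.congr hTl, ?_⟩
  rw [← hm.tsum_eq]
  simp only [mul_div_assoc]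
  rw [tsum_mul_left]
  change Complex.Gammaℝ s * ∑' n : ι → ℤ, T (latticePoint b n) = _
  rw [h2, tsum_congr hTl, Complex.Gammaℝ_def, gammaFactor, lSeries]
  ring

end Lattices

/-! ### Bounded windows and the partition of the dual lattice into shells -/

section Windows

variable {u : (𝓞 K)ˣ} {x : InfinitePlace K → ℝ} {c : Set (InfinitePlace K)}

lemma exists_norm_le_of_mem_window : ∃ R : ℝ, ∀ y ∈ window σ u x c, ‖y‖ ≤ R := by
  let r : InfinitePlace K → ℝ := fun w => (w ((u : 𝓞 K) : K)) ^ (x w)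
  have hr : ∀ w, 0 ≤ r w := fun w => Real.rpow_nonneg (apply_nonneg _ _) _
  have hR : ∀ w, r w ≤ ∑ w, r w := fun w =>
    Finset.single_le_sum (fun w _ => hr w) (Finset.mem_univ w)
  have hR0 : 0 ≤ ∑ w, r w := Finset.sum_nonneg fun w _ => hr w
  refine ⟨∑ w, r w, fun y hy => max_le ?_ ?_⟩
  · refine (pi_norm_le_iff_of_nonneg hR0).2 fun w => le_trans ?_ (hR w.1.1)
    by_cases hc : w.1.1 ∈ c
    · exact (hy.1 w).1 hc
    · exact ((hy.1 w).2 hc).le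
  · refine (pi_norm_le_iff_of_nonneg hR0).2 fun w => le_trans ?_ (hR w.1)
    by_cases hc : w.1 ∈ c
    · exact (hy.2 w).1 hc
    · exact ((hy.2 w).2 hc).le

variable {D : Set (CoSpace σ)}

lemma mem_smul_dualWindow {r : ℝ} (hr : 0 < r) {η : CoSpace σ} :
    η ∈ r • dualWindow σ D ↔ ∀ y ∈ D, |tracePairing σ η y| ≤ r * (Real.pi / 3) := by
  have hpi : (0 : ℝ) < Real.pi / 3 := by positivity
  rw [dualWindow, mem_smul_set_iff_inv_smul_mem₀ hr.ne', mem_smul_set_iff_inv_smul_mem₀ hpi.ne',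
    mem_ofPred_eq]
  refine forall₂_congr fun y _ => ?_
  rw [tracePairing_smul_left, tracePairing_smul_left, abs_mul, abs_mul, abs_of_pos (inv_pos.2 hr),
    abs_of_pos (inv_pos.2 hpi), inv_mul_le_iff₀ hpi, inv_mul_le_iff₀ hr, mul_one]

lemma exists_mem_smul_dualWindow {R : ℝ} (hR : ∀ y ∈ D, ‖y‖ ≤ R) (η : CoSpace σ) :
    ∃ n : ℕ, η ∈ ((n + 1 : ℕ) : ℝ) • dualWindow σ D := by
  obtain ⟨n, hn⟩ := exists_nat_ge (‖traceBilin σ‖ * ‖η‖ * R)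
  refine ⟨n, (mem_smul_dualWindow (by positivity)).2 fun y hy => ?_⟩
  have h1 : |tracePairing σ η y| ≤ ‖traceBilin σ‖ * ‖η‖ * R :=
    ((traceBilin σ).le_opNorm₂ η y).trans
      (mul_le_mul_of_nonneg_left (hR y hy) (by positivity))
  -- As `π / 3 ≥ 1`, the factor in `dualWindow` only enlarges the polar set.
  have h2 : (1 : ℝ) ≤ Real.pi / 3 := by linarith [Real.pi_gt_three]
  push_cast
  nlinarith [Nat.cast_nonneg (α := ℝ) n]

lemma smul_dualWindow_mono {m n : ℕ} (h : m ≤ n) :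
    ((m + 1 : ℕ) : ℝ) • dualWindow σ D ⊆ ((n + 1 : ℕ) : ℝ) • dualWindow σ D := fun η hη => by
  rw [mem_smul_dualWindow (by positivity)] at hη ⊢
  refine fun y hy => (hη y hy).trans ?_
  gcongr

variable (A : (FractionalIdeal (𝓞 K)⁰ K)ˣ)

lemma dualShell_subset (n : ℕ) : dualShell σ A D n ⊆ dualLattice A := by
  match n with
  | 0 => exact empty_subset _
  | 1 => exact fun ξ hξ => hξ.1
  | n + 2 => exact fun ξ hξ => hξ.1.1

/-- The dilates are nested, so a shell collects the points whose first containing dilate has the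
given index. `Nat.find` counts from `0`, the dilates from `1`. -/
lemma mem_dualShell_succ (hex : ∀ η : CoSpace σ, ∃ n : ℕ, η ∈ ((n + 1 : ℕ) : ℝ) • dualWindow σ D)
    (n : ℕ) (ξ : K) :
    ξ ∈ dualShell σ A D (n + 1) ↔ ξ ∈ dualLattice A ∧ Nat.find (hex (conj σ ξ)) = n := by
  rw [Nat.find_eq_iff]
  match n with
  | 0 => simp [dualShell, dualModelSet, modelSet]
  | n + 1 =>
    constructor
    · rintro ⟨⟨h1, h2⟩, h3⟩
      exact ⟨h1, h2, fun m hm hmem => h3 ⟨h1, smul_dualWindow_mono (by omega) hmem⟩⟩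
    · rintro ⟨h1, h2, h3⟩
      exact ⟨⟨h1, h2⟩, fun h => h3 n (by omega) h.2⟩

/-- The shells are the fibres of that first index, and a summable family may be summed fibre by
fibre. -/
lemma hasSum_dualShell (hex : ∀ η : CoSpace σ, ∃ n : ℕ, η ∈ ((n + 1 : ℕ) : ℝ) • dualWindow σ D)
    {T : K → ℂ} (hT : Summable fun α : positives σ (dualLattice A) => T α) :
    HasSum (fun n => ∑' ξ : positives σ (dualShell σ A D (n + 1)), T ξ)
      (∑' ξ : positives σ (dualLattice A), T ξ) := by
  have h1 : Summable ((positives σ (dualLattice A)).indicator T) :=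
    summable_subtype_iff_indicator.1 hT
  rw [tsum_subtype]
  refine (h1.hasSum.tsum_fiberwise fun ξ => Nat.find (hex (conj σ ξ))).congr_fun fun n => ?_
  have hset : positives σ (dualShell σ A D (n + 1)) =
      (fun ξ => Nat.find (hex (conj σ ξ))) ⁻¹' {n} ∩ positives σ (dualLattice A) := by
    ext ξ
    simp only [positives, mem_ofPred_eq, mem_dualShell_succ A hex, mem_inter_iff, mem_preimage,
      mem_singleton_iff]
    tauto
  rw [tsum_subtype ((fun ξ => Nat.find (hex (conj σ ξ))) ⁻¹' {n}), tsum_subtype,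
    indicator_indicator, hset]

end Windows

lemma positives_mono {X Y : Set K} (h : X ⊆ Y) : positives σ X ⊆ positives σ Y :=
  fun _ hα => ⟨h hα.1, hα.2⟩

lemma summable_positives_mono {X Y : Set K} (h : X ⊆ Y) {T : K → ℂ}
    (hT : Summable fun α : positives σ Y => T α) : Summable fun α : positives σ X => T α :=
  hT.comp_injective (inclusion_injective (positives_mono h))

lemma lSeries_modelSet {f : CoSpace σ → ℂ} {D : Set (CoSpace σ)} (hf : ∀ y, y ∉ D → f y = 0)
    (Γ : Set K) (s : ℂ) :
    lSeries σ (modelSet σ Γ D) (weight σ f) s = lSeries σ Γ (weight σ f) s := by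
  rw [lSeries, lSeries, tsum_subtype, tsum_subtype]
  refine tsum_congr fun α => ?_
  by_cases hD : conj σ α ∈ D
  · have : α ∈ positives σ (modelSet σ Γ D) ↔ α ∈ positives σ Γ :=
      ⟨fun h => ⟨h.1.1, h.2⟩, fun h => ⟨⟨h.1, hD⟩, h.2⟩⟩
    simp only [indicator_apply, this]
  · have : lTerm σ (weight σ f) s α = 0 := by simp [lTerm, weight, hf _ hD]
    simp [indicator_apply, this]

end Series

end Quasicrystal

theorem mainTheorem6 {K : Type*} [Field K] [NumberField K]
    (hd : 1 < Module.finrank ℚ K)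
    (σ : Quasicrystal.RealPlace K)
    (A : (FractionalIdeal (𝓞 K)⁰ K)ˣ)
    (u : (𝓞 K)ˣ) (hu : ∀ w : InfinitePlace K, w ≠ σ.1 → w ((u : 𝓞 K) : K) < 1)
    (x : InfinitePlace K → ℝ) (c : Set (InfinitePlace K))
    (D : Set (Quasicrystal.CoSpace σ)) (hD : D = Quasicrystal.window σ u x c)
    (f : SchwartzMap (Quasicrystal.CoSpace σ) ℂ)
    (hf_even : ∀ y, f (-y) = f y)
    (hf_supp : ∀ y, y ∉ D → f y = 0) :
    -- the series converge for `Re s > 1`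
    (∀ s : ℂ, 1 < s.re →
      (Summable fun α : Quasicrystal.positives σ
          (Quasicrystal.modelSet σ (Quasicrystal.lattice A) D) =>
        Quasicrystal.lTerm σ (Quasicrystal.weight σ f) s α) ∧
      (∀ n : ℕ, 1 ≤ n → Summable fun ξ : Quasicrystal.positives σ
          (Quasicrystal.dualShell σ A D n) =>
        Quasicrystal.lTerm σ (Quasicrystal.dualWeight σ f) s ξ) ∧
      (Summable fun n : ℕ => Quasicrystal.dualLSeriesLevel σ A D f (n + 1) s)) ∧
    -- `F` and `G` continue `Λ(𝔪, χ, s)` and `Λ^∨(𝔪, χ, s)`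
    ∃ F G : ℂ → ℂ,
      (∀ s, MeromorphicAt F s) ∧ (∀ s, MeromorphicAt G s) ∧
      (∀ s, s ≠ 0 → s ≠ 1 → AnalyticAt ℂ F s) ∧ (∀ s, s ≠ 0 → s ≠ 1 → AnalyticAt ℂ G s) ∧
      (∀ s : ℂ, 1 < s.re → F s = Quasicrystal.completedL σ A D f s) ∧
      (∀ s : ℂ, 1 < s.re → G s = Quasicrystal.completedDualL σ A D f s) ∧
      Quasicrystal.HasSimplePole F 0 (-Quasicrystal.weight σ f 0) ∧
      Quasicrystal.HasSimplePole F 1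
        ((Quasicrystal.discConst A : ℂ) * Quasicrystal.dualWeight σ f 0) ∧
      ∀ s, s ≠ 0 → s ≠ 1 → F s = (Quasicrystal.discConst A : ℂ) * G (1 - s) := by
  open Quasicrystal in
  obtain ⟨R, hR⟩ := exists_norm_le_of_mem_window (σ := σ) (u := u) (x := x) (c := c)
  have hex := exists_mem_smul_dualWindow (D := D) (fun y hy => hR y (hD ▸ hy))
  set b := basisOfFractionalIdeal K A with hb
  have h1 : ∀ s : ℂ, 1 < s.re → _ := fun s hs =>
    summable_positives_and_mellin b (rapidDecay_schwartz f) hf_even hs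
  have h2 : ∀ s : ℂ, 1 < s.re → _ := fun s hs =>
    summable_positives_and_mellin b.traceDual (rapidDecay_fourierDual f) (fourierDual_neg hf_even) hs
  rw [hb, ← lattice_eq_range] at h1
  rw [hb, ← dualLattice_eq_range] at h2
  have h3 : ∀ s : ℂ, 1 < s.re → HasSum (fun n => dualLSeriesLevel σ A D f (n + 1) s)
      (lSeries σ (dualLattice A) (dualWeight σ f) s) := fun s hs =>
    hasSum_dualShell A hex (h2 s hs).1
  let P := thetaPair A f
  have hk : P.k = 1 / 2 := rfl
  have hk' : P.symm.k = 1 / 2 := rfl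
  have hre : ∀ s : ℂ, 1 < s.re → 1 / 2 < (s / 2).re := fun s hs => by
    rw [Complex.div_ofNat_re]; linarith
  have h0 : conj σ (0 : K) = 0 := congrArg Prod.snd (map_zero (toAmbient σ))
  refine ⟨fun s hs => ⟨summable_positives_mono (fun α hα => hα.1) (h1 s hs).1,
    fun n _ => summable_positives_mono (dualShell_subset A n) (h2 s hs).1, (h3 s hs).summable⟩,
    halfLambda P, halfLambda P.symm, meromorphicAt_halfLambda hk, meromorphicAt_halfLambda hk',
    fun s => analyticAt_halfLambda hk, fun s => analyticAt_halfLambda hk', fun s hs => ?_,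
    fun s hs => ?_, ?_, ?_, fun s _ _ => halfLambda_one_sub hk s⟩
  · rw [completedL, lSeries_modelSet hf_supp, halfLambda, ← (P.hasMellin (hre s hs)).2]
    -- The `2` from folding by `α ↦ -α` cancels the one in `halfLambda`.
    exact (div_eq_iff two_ne_zero).2 (((h1 s hs).2).trans (mul_comm _ _))
  · rw [completedDualL, dualLSeries, (h3 s hs).tsum_eq, halfLambda,
      ← (P.symm.hasMellin (hre s hs)).2]
    exact (div_eq_iff two_ne_zero).2 (((h2 s hs).2).trans (mul_comm _ _))
  · rw [weight, h0]
    exact hasSimplePole_halfLambda_zero hk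
  · rw [dualWeight, h0]
    exact hasSimplePole_halfLambda_one hk
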